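/- All paratopological groups (groups with a topology making multiplication jointly continuous) are assumed to satisfy the $T_0$ separation axiom. For a paratopological group $G$, let $G^\sharp$ be the topological group with the same underlying group and with the sets $U\cap U^{-1}$, $U$ a neighborhood of the identity $e$ in $G$, as a neighborhood base at $e$. The Raĭkov completion $\breve G$ of $G$ is the paratopological group whose underlying group is the Raĭkov completion $\varrho G^\sharp$ of $G^\sharp$ (the completion with respect to the two-sided uniformity) and in which the closures in $\varrho G^\sharp$ of the neighborhoods $U$ of $e$ in $G$ form a neighborhood base at the identity; it contains $G$ as a subgroup. Given a class $\mathcal C$ of continuous homomorphisms between paratopological groups, a paratopological group $H$ is called $\mathcal C$-complete if every homomorphism $h\colon X\to H$ in $\mathcal C$ extends to a continuous homomorphism $\breve X\to H$. The $\mathcal C$-completion $\mathcal C[G]$ of $G$ is the intersection of all $\mathcal C$-complete subgroups of $\breve G$ that contain $G$, with the subspace topology. A paratopological group $G$ is *projectively $\Psi$* if for every neighborhood $U$ of the identity in $G$ there is a continuous homomorphism $h\colon G\to Y$ to a Hausdorff paratopological group $Y$ of countable pseudocharacter (every point of $Y$ is a $G_\delta$-set) with $h^{-1}(e_Y)\subseteq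 U$. It is *$\omega$-balanced* if for every neighborhood $U$ of the identity there is a countable family $\mathcal V$ of neighborhoods of the identity such that for each $x\in G$ there is $V\in\mathcal V$ with $xVx^{-1}\subseteq U$. The *Hausdorff number* $Hs(G)$ of a Hausdorff paratopological group $G$ is the smallest cardinal $\kappa\ge 1$ such that for every neighborhood $U$ of the identity there is a family $\{V_\alpha\}_{\alpha\in\kappa}$ of neighborhoods of the identity with $\bigcap_{\alpha\in\kappa}V_\alpha V_\alpha^{-1}\subseteq U$. **Theorem.** Let $\mathcal C$ be any subclass of the class of continuous homomorphisms from pseudocompact topological groups to paratopological groups, and let $G$ be a paratopological group. 1. If $G$ is projectively $\Psi$, then $\mathcal C[G]$ is Hausdorff. 2. If $G$ is Hausdorff and $\omega$-balanced and satisfies $Hs(G)\le\omega$, then $\mathcal C[G]$ is $\omega$-balanced and Hausdorff, and $Hs(\mathcal C[G])\le\omega$. -/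

import Mathlib

open Filter Topology Uniformity Pointwise Set Cardinal

universe u v

/-- A `T₀` paratopological group: a group with a `T₀` topology and jointly continuous
multiplication. -/
class ParatopologicalGroup (G : Type u) [Group G] [TopologicalSpace G] : Prop
  extends ContinuousMul G, T0Space G

instance Subgroup.instParatopologicalGroup {G : Type u} [Group G] [TopologicalSpace G]
    [ParatopologicalGroup G] (H : Subgroup G) : ParatopologicalGroup H where
  toContinuousMul := inferInstanceAs (ContinuousMul H.toSubmonoid)
  toT0Space := inferInstance

/-! ### The Raĭkov completion of a topological group -/

section TwoSided

variable (H : Type u) [Group H] [TopologicalSpace H] [IsTopologicalGroup H]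

/-- The two-sided uniformity of a topological group: the join of the left and the right one. -/
abbrev twoSidedUniformSpace : UniformSpace H :=
  (IsTopologicalGroup.leftUniformSpace H ⊓ IsTopologicalGroup.rightUniformSpace H).replaceTopology
    (inf_idem _).symm

/-- The Raĭkov completion of a topological group: the (separated) completion of its two-sided
uniformity. -/
def TopRaikov : Type u := @UniformSpace.Completion H (twoSidedUniformSpace H)

namespace TopRaikov

attribute [local instance] twoSidedUniformSpace

instance : UniformSpace (TopRaikov H) := inferInstanceAs (UniformSpace (UniformSpace.Completion H))
instance : CompleteSpace (TopRaikov H) :=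
  inferInstanceAs (CompleteSpace (UniformSpace.Completion H))
instance : T0Space (TopRaikov H) := inferInstanceAs (T0Space (UniformSpace.Completion H))

variable {H}

/-- The canonical map of a topological group to its Raĭkov completion. -/
def of (x : H) : TopRaikov H := ((x : UniformSpace.Completion H))

theorem isDenseInducing_of : IsDenseInducing (of : H → TopRaikov H) :=
  UniformSpace.Completion.isDenseInducing_coe

theorem continuous_of : Continuous (of : H → TopRaikov H) := isDenseInducing_of.continuous

theorem isUniformInducing_of : IsUniformInducing (of : H → TopRaikov H) :=
  UniformSpace.Completion.isUniformInducing_coe H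

theorem uniformity_basis_aux {s : Set (H × H)} :
    s ∈ 𝓤 H ↔ ∃ W ∈ 𝓝 (1 : H), ∀ x y, x⁻¹ * y ∈ W → y * x⁻¹ ∈ W → (x, y) ∈ s := by
  change s ∈ comap (fun p : H × H => p.1⁻¹ * p.2) (𝓝 1) ⊓
    comap (fun p : H × H => p.2 * p.1⁻¹) (𝓝 1) ↔ _
  rw [mem_inf_iff_superset]
  constructor
  · rintro ⟨a, ⟨V, hV, hVa⟩, b, ⟨W, hW, hWb⟩, hs⟩
    exact ⟨V ∩ W, inter_mem hV hW, fun x y h1 h2 => hs ⟨hVa h1.1, hWb h2.2⟩⟩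
  · rintro ⟨W, hW, h⟩
    exact ⟨_, preimage_mem_comap hW, _, preimage_mem_comap hW, fun p hp => h p.1 p.2 hp.1 hp.2⟩

theorem cauchy_mul {F F' : Filter H} (hF : Cauchy F) (hF' : Cauchy F') :
    Cauchy (map (fun p : H × H => p.1 * p.2) (F ×ˢ F')) := by
  have := hF.1
  have := hF'.1
  refine ⟨inferInstance, ?_⟩
  intro s hs
  obtain ⟨W, hW, hWs⟩ := uniformity_basis_aux.1 hs
  obtain ⟨V, hV, hVW⟩ : ∃ V ∈ 𝓝 (1 : H), ∀ t ∈ V, ∀ r ∈ V, ∀ z ∈ V,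
      t * (r⁻¹ * z * r) ∈ W ∧ r * z * r⁻¹ * t ∈ W := by
    have h1 : Tendsto (fun p : H × H × H => p.1 * (p.2.1⁻¹ * p.2.2 * p.2.1))
        (𝓝 (1, 1, 1)) (𝓝 1) := by
      have : Continuous (fun p : H × H × H => p.1 * (p.2.1⁻¹ * p.2.2 * p.2.1)) := by fun_prop
      simpa using this.tendsto (1, 1, 1)
    have h2 : Tendsto (fun p : H × H × H => p.2.1 * p.2.2 * p.2.1⁻¹ * p.1)
        (𝓝 (1, 1, 1)) (𝓝 1) := by
      have : Continuous (fun p : H × H × H => p.2.1 * p.2.2 * p.2.1⁻¹ * p.1) := by fun_prop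
      simpa using this.tendsto (1, 1, 1)
    have h5 := inter_mem (mem_map.1 (h1 hW)) (mem_map.1 (h2 hW))
    rw [nhds_prod_eq, nhds_prod_eq, mem_prod_iff] at h5
    obtain ⟨A, hA, B, hB, hAB⟩ := h5
    obtain ⟨C, hC, D, hD, hCD⟩ := mem_prod_iff.1 hB
    refine ⟨A ∩ (C ∩ D), inter_mem hA (inter_mem hC hD), fun t ht r hr z hz => ?_⟩
    exact @hAB (t, r, z) ⟨ht.1, hCD ⟨hr.2.1, hz.2.2⟩⟩
  have diam : ∀ {F : Filter H}, Cauchy F → ∀ V ∈ 𝓝 (1 : H), ∃ A ∈ F, ∀ x ∈ A, ∀ y ∈ A,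
      x⁻¹ * y ∈ V ∧ y * x⁻¹ ∈ V := by
    intro F hF V hV
    obtain ⟨A, hA, h⟩ := (cauchy_iff.1 hF).2 {p : H × H | p.1⁻¹ * p.2 ∈ V ∧ p.2 * p.1⁻¹ ∈ V}
      (uniformity_basis_aux.2 ⟨V, hV, fun x y h1 h2 => ⟨h1, h2⟩⟩)
    exact ⟨A, hA, fun x hx y hy => h (mk_mem_prod hx hy)⟩
  obtain ⟨A, hA, hdA⟩ := diam hF V hV
  obtain ⟨B, hB, hdB⟩ := diam hF' V hV
  obtain ⟨a, ha⟩ := hF.1.nonempty_of_mem hA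
  obtain ⟨b, hb⟩ := hF'.1.nonempty_of_mem hB
  have hb1 : Tendsto (fun z : H => b⁻¹ * z * b) (𝓝 1) (𝓝 1) := by
    have : Continuous (fun z : H => b⁻¹ * z * b) := by fun_prop
    simpa using this.tendsto 1
  have ha1 : Tendsto (fun z : H => a * z * a⁻¹) (𝓝 1) (𝓝 1) := by
    have : Continuous (fun z : H => a * z * a⁻¹) := by fun_prop
    simpa using this.tendsto 1
  obtain ⟨A', hA', hdA'⟩ := diam hF _ (hb1 hV)
  obtain ⟨B', hB', hdB'⟩ := diam hF' _ (ha1 hV)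
  have hmem : (fun p : H × H => p.1 * p.2) '' ((A ∩ A') ×ˢ (B ∩ B')) ∈
      map (fun p : H × H => p.1 * p.2) (F ×ˢ F') :=
    image_mem_map (prod_mem_prod (inter_mem hA hA') (inter_mem hB hB'))
  refine mem_of_superset (prod_mem_prod hmem hmem) ?_
  rintro ⟨_, _⟩ ⟨⟨⟨x, y⟩, ⟨hx, hy⟩, rfl⟩, ⟨⟨x', y'⟩, ⟨hx', hy'⟩, rfl⟩⟩
  refine hWs _ _ ?_ ?_
  · have := (hVW (y⁻¹ * y') (hdB y hy.1 y' hy'.1).1 (b⁻¹ * y') (hdB b hb y' hy'.1).1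
      (b⁻¹ * (x⁻¹ * x') * b) (hdA' x hx.2 x' hx'.2).1).1
    convert this using 1
    group
  · have := (hVW (x' * x⁻¹) (hdA x hx.1 x' hx'.1).2 (x' * a⁻¹) (hdA a ha x' hx'.1).2
      (a * (y' * y⁻¹) * a⁻¹) (hdB' y hy.2 y' hy'.2).2).2
    convert this using 1
    group

theorem uniformContinuous_inv_aux : UniformContinuous (fun x : H => x⁻¹) := by
  intro s hs
  obtain ⟨W, hW, hWs⟩ := uniformity_basis_aux.1 hs
  refine uniformity_basis_aux.2 ⟨W⁻¹, inv_mem_nhds_one H hW, fun x y h1 h2 => hWs _ _ ?_ ?_⟩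
  · simpa using h2
  · simpa using h1

noncomputable instance : One (TopRaikov H) := ⟨of 1⟩

/-- Inversion on the completion: the continuous extension of the inversion of `H`. -/
noncomputable instance : Inv (TopRaikov H) :=
  ⟨isDenseInducing_of.extend (fun x : H => of x⁻¹)⟩

/-- Multiplication on the completion: the continuous extension of the multiplication of `H`. -/
noncomputable instance : Mul (TopRaikov H) :=
  ⟨fun x y => (isDenseInducing_of.prodMap isDenseInducing_of).extend
    (fun p : H × H => of (p.1 * p.2)) (x, y)⟩

theorem continuous_mul_aux : Continuous (fun p : TopRaikov H × TopRaikov H => p.1 * p.2) := by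
  refine (isDenseInducing_of.prodMap isDenseInducing_of).continuous_extend
    (f := fun p : H × H => of (p.1 * p.2)) ?_
  rintro ⟨x, y⟩
  have hc : ∀ x : TopRaikov H, Cauchy (comap of (𝓝 x)) := fun x =>
    (isUniformInducing_of.cauchy_map_iff).1
      (cauchy_nhds.mono' (by have := isDenseInducing_of.comap_nhds_neBot x; infer_instance)
        map_comap_le)
  have h := (isUniformInducing_of.cauchy_map_iff).2 (cauchy_mul (hc x) (hc y))
  obtain ⟨c, hc⟩ := CompleteSpace.complete h
  refine ⟨c, ?_⟩
  have hp : comap (Prod.map of of) (𝓝 (x, y)) = comap (of : H → _) (𝓝 x) ×ˢ comap of (𝓝 y) := by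
    rw [nhds_prod_eq, prod_comap_comap_eq]; rfl
  rw [hp]
  rw [map_map] at hc
  exact hc

theorem continuous_inv_aux : Continuous (fun p : TopRaikov H => p⁻¹) :=
  (uniformContinuous_uniformly_extend isUniformInducing_of isDenseInducing_of.dense
    (isUniformInducing_of.uniformContinuous.comp uniformContinuous_inv_aux)).continuous

theorem of_mul (x y : H) : of (x * y) = of x * of y :=
  ((isDenseInducing_of.prodMap isDenseInducing_of).extend_eq
    (f := fun p : H × H => of (p.1 * p.2)) (continuous_of.comp continuous_mul) (x, y)).symm

theorem of_inv (x : H) : of x⁻¹ = (of x)⁻¹ :=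
  (isDenseInducing_of.extend_eq (continuous_of.comp continuous_inv) x).symm

theorem eq_of_eq_on_of {f g : TopRaikov H → TopRaikov H} (hf : Continuous f) (hg : Continuous g)
    (h : ∀ a : H, f (of a) = g (of a)) (x : TopRaikov H) : f x = g x :=
  congrFun (isDenseInducing_of.dense.equalizer hf hg (funext h)) x

noncomputable instance : Group (TopRaikov H) where
  mul_assoc x y z := by
    have hm := @continuous_mul_aux H _ _ _
    have hd : DenseRange (Prod.map of (Prod.map of of) : H × H × H → _) :=
      isDenseInducing_of.dense.prodMap
        (isDenseInducing_of.dense.prodMap (isDenseInducing_of (H := H)).dense)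
    have := hd.equalizer
      (g := fun p : TopRaikov H × TopRaikov H × TopRaikov H => p.1 * p.2.1 * p.2.2)
      (h := fun p => p.1 * (p.2.1 * p.2.2))
      (hm.comp ((hm.comp (continuous_fst.prodMk continuous_snd.fst)).prodMk continuous_snd.snd))
      (hm.comp (continuous_fst.prodMk (hm.comp continuous_snd)))
      (by funext ⟨a, b, c⟩; simp [← of_mul, mul_assoc])
    exact congrFun this (x, y, z)
  one_mul := eq_of_eq_on_of (continuous_mul_aux.comp (continuous_const.prodMk continuous_id))
    continuous_id (fun a => (of_mul 1 a).symm.trans (by simp))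
  mul_one := eq_of_eq_on_of (continuous_mul_aux.comp (continuous_id.prodMk continuous_const))
    continuous_id (fun a => (of_mul a 1).symm.trans (by simp))
  inv_mul_cancel := eq_of_eq_on_of (g := fun _ => 1)
    (continuous_mul_aux.comp (continuous_inv_aux.prodMk continuous_id)) continuous_const
    (fun a => by
      change (of a)⁻¹ * of a = of 1
      rw [← of_inv, ← of_mul, inv_mul_cancel])

instance : IsTopologicalGroup (TopRaikov H) where
  continuous_mul := continuous_mul_aux
  continuous_inv := continuous_inv_aux

end TopRaikov
end TwoSided

/-! ### The Raĭkov completion of a paratopological group -/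

section Para

variable (G : Type u) [Group G] [TopologicalSpace G]

/-- The group coreflection `G^♯` of a paratopological group `G`: the same group with the
topology induced by `x ↦ (x, x⁻¹)`, so that the sets `U ∩ U⁻¹` form a base at the identity. -/
def Coreflection : Type u := G

namespace Coreflection

instance : Group (Coreflection G) := inferInstanceAs (Group G)

variable {G} in
/-- The identity map from `G` to its group coreflection. -/
def of : G ≃* Coreflection G := MulEquiv.refl G

instance : TopologicalSpace (Coreflection G) :=
  TopologicalSpace.induced (fun x => (of.symm x, (of.symm x)⁻¹)) inferInstance

variable {G}

theorem continuous_aux : Continuous (fun x : Coreflection G => (of.symm x, (of.symm x)⁻¹)) :=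
  continuous_induced_dom

theorem mem_nhds_one {s : Set (Coreflection G)} :
    s ∈ 𝓝 (1 : Coreflection G) ↔ ∃ U ∈ 𝓝 (1 : G), of '' (U ∩ U⁻¹) ⊆ s := by
  rw [nhds_induced, map_one, inv_one, nhds_prod_eq, mem_comap]
  constructor
  · rintro ⟨t, ht, hts⟩
    obtain ⟨A, hA, B, hB, hAB⟩ := mem_prod_iff.1 ht
    refine ⟨A ∩ B, inter_mem hA hB, ?_⟩
    rintro _ ⟨x, hx, rfl⟩
    exact hts (hAB ⟨by simpa using hx.1.1, by simpa using hx.2.2⟩)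
  · rintro ⟨U, hU, hs⟩
    exact ⟨U ×ˢ U, prod_mem_prod hU hU, fun x hx => hs ⟨of.symm x, ⟨hx.1, hx.2⟩, by simp⟩⟩

instance [ContinuousMul G] : IsTopologicalGroup (Coreflection G) where
  continuous_mul := by
    have h1 := continuous_aux.comp (continuous_fst (X := Coreflection G) (Y := Coreflection G))
    have h2 := continuous_aux.comp (continuous_snd (X := Coreflection G) (Y := Coreflection G))
    refine continuous_induced_rng.2 (((h1.fst.mul h2.fst).prodMk (h2.snd.mul h1.snd)).congr ?_)
    intro p
    simp
  continuous_inv := by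
    have h := continuous_aux (G := G)
    refine continuous_induced_rng.2 ((h.snd.prodMk h.fst).congr ?_)
    intro p
    simp

end Coreflection

variable [ParatopologicalGroup G]

/-- The Raĭkov completion `Ğ` of a paratopological group `G`. As a group it is the Raĭkov
completion of the topological group `G^♯`; its topology is defined below. -/
def RaikovCompletion : Type u := TopRaikov (Coreflection G)

namespace RaikovCompletion

noncomputable instance : Group (RaikovCompletion G) :=
  inferInstanceAs (Group (TopRaikov (Coreflection G)))

variable {G}

/-- The identity map from `Ğ` to the Raĭkov completion of `G^♯`. -/
noncomputable def toSharp : RaikovCompletion G ≃* TopRaikov (Coreflection G) := MulEquiv.refl _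

/-- The canonical homomorphism from `G` to `Ğ`. -/
noncomputable def of : G →* RaikovCompletion G :=
  MonoidHom.mk' (fun x => toSharp.symm (TopRaikov.of (Coreflection.of x))) fun x y => by
    rw [map_mul, TopRaikov.of_mul, map_mul]

/-- The closure of (the image of) `U ⊆ G` in the Raĭkov completion of `G^♯`. -/
def sharpClosure (U : Set G) : Set (RaikovCompletion G) :=
  toSharp ⁻¹' closure (toSharp '' (of '' U))

variable (G) in
/-- The filter generated by the sets `sharpClosure U`, where `U` is a neighborhood of the identity
in `G`. -/
def nhdsOne : Filter (RaikovCompletion G) := (𝓝 (1 : G)).lift' sharpClosure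

/-- The topology of `Ğ`: a neighborhood base at `x` consists of the sets `x * sharpClosure U`,
where `U` is a neighborhood of the identity in `G` (see `nhds_eq` below). -/
noncomputable instance : TopologicalSpace (RaikovCompletion G) :=
  TopologicalSpace.mkOfNhds fun x => map (fun y => x * y) (nhdsOne G)

theorem mem_sharpClosure {U : Set G} {a : RaikovCompletion G} :
    a ∈ sharpClosure U ↔ toSharp a ∈ closure (toSharp '' (of '' U)) := Iff.rfl

theorem sharpClosure_mono {U V : Set G} (h : U ⊆ V) :
    (sharpClosure U : Set (RaikovCompletion G)) ⊆ sharpClosure V :=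
  preimage_mono (closure_mono (image_mono (image_mono h)))

theorem mem_nhdsOne {s : Set (RaikovCompletion G)} :
    s ∈ nhdsOne G ↔ ∃ U ∈ 𝓝 (1 : G), sharpClosure U ⊆ s :=
  mem_lift'_sets fun _ _ h => sharpClosure_mono h

theorem of_mem_sharpClosure {U : Set G} {x : G} (h : x ∈ U) :
    (of x : RaikovCompletion G) ∈ sharpClosure U :=
  mem_sharpClosure.2 (subset_closure (mem_image_of_mem _ (mem_image_of_mem _ h)))

theorem mul_mem_sharpClosure {U V W : Set G} (h : ∀ x ∈ U, ∀ y ∈ V, x * y ∈ W)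
    {a b : RaikovCompletion G} (ha : a ∈ sharpClosure U) (hb : b ∈ sharpClosure V) :
    a * b ∈ sharpClosure W := by
  rw [mem_sharpClosure] at ha hb ⊢
  rw [map_mul]
  refine map_mem_closure₂ continuous_mul ha hb ?_
  rintro _ ⟨_, ⟨x, hx, rfl⟩, rfl⟩ _ ⟨_, ⟨y, hy, rfl⟩, rfl⟩
  exact ⟨_, ⟨x * y, h x hx y hy, rfl⟩, by rw [map_mul, map_mul]⟩

theorem exists_mul_mem {U : Set G} (hU : U ∈ 𝓝 (1 : G)) :
    ∃ V ∈ 𝓝 (1 : G), ∀ x ∈ V, ∀ y ∈ V, x * y ∈ U := by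
  obtain ⟨V, hV, h1, h⟩ := exists_open_nhds_one_mul_subset hU
  exact ⟨V, hV.mem_nhds h1, fun x hx y hy => h (mul_mem_mul hx hy)⟩

theorem one_mem_sharpClosure {U : Set G} (hU : U ∈ 𝓝 (1 : G)) :
    (1 : RaikovCompletion G) ∈ sharpClosure U := by
  simpa using of_mem_sharpClosure (mem_of_mem_nhds hU)

theorem tendsto_mul_nhdsOne :
    Tendsto (Function.uncurry ((· * ·) : RaikovCompletion G → _ → _))
      (nhdsOne G ×ˢ nhdsOne G) (nhdsOne G) := by
  intro s hs
  obtain ⟨U, hU, hUs⟩ := mem_nhdsOne.1 hs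
  obtain ⟨V, hV, hVU⟩ := exists_mul_mem hU
  have := mem_nhdsOne.2 ⟨V, hV, subset_rfl⟩
  refine mem_map.2 (mem_of_superset (prod_mem_prod this this) ?_)
  rintro ⟨a, b⟩ ⟨ha, hb⟩
  exact hUs (mul_mem_sharpClosure hVU ha hb)

theorem nhds_eq (x : RaikovCompletion G) : 𝓝 x = map (fun y => x * y) (nhdsOne G) := by
  refine TopologicalSpace.nhds_mkOfNhds _ x ?_ ?_
  · intro a s hs
    obtain ⟨U, hU, hUs⟩ := mem_nhdsOne.1 (mem_map.1 hs)
    simpa using hUs (one_mem_sharpClosure hU)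
  · intro a s hs
    obtain ⟨U, hU, hUs⟩ := mem_nhdsOne.1 (mem_map.1 hs)
    obtain ⟨V, hV, hVU⟩ := exists_mul_mem hU
    refine mem_map.2 (mem_nhdsOne.2 ⟨V, hV, fun y hy => ?_⟩)
    refine mem_map.2 (mem_nhdsOne.2 ⟨V, hV, fun z hz => ?_⟩)
    have := hUs (mul_mem_sharpClosure hVU hy hz)
    simpa [mul_assoc] using this

theorem nhds_one : 𝓝 (1 : RaikovCompletion G) = nhdsOne G := by
  simp [nhds_eq]

theorem exists_of_mul (x : RaikovCompletion G) {V : Set G} (hV : V ∈ 𝓝 (1 : G)) :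
    ∃ (g : G) (t : RaikovCompletion G), x = t * of g ∧ t ∈ sharpClosure V ∧
      t⁻¹ ∈ sharpClosure V := by
  have hN : Coreflection.of '' (V ∩ V⁻¹) ∈ 𝓝 (1 : Coreflection G) :=
    Coreflection.mem_nhds_one.2 ⟨V, hV, subset_rfl⟩
  have hN' := TopRaikov.isDenseInducing_of.closure_image_mem_nhds hN
  have hc : Tendsto (fun y => toSharp x * y⁻¹) (𝓝 (toSharp x)) (𝓝 (TopRaikov.of 1)) := by
    have : Continuous (fun y => toSharp x * y⁻¹) := by fun_prop
    have h := this.tendsto (toSharp x)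
    rwa [mul_inv_cancel] at h
  obtain ⟨_, hy, g, rfl⟩ := mem_closure_iff_nhds.1
    (TopRaikov.isDenseInducing_of.dense (toSharp x)) _ (hc hN')
  refine ⟨Coreflection.of.symm g, x * (of (Coreflection.of.symm g))⁻¹, by group, ?_, ?_⟩
  · rw [mem_sharpClosure]
    refine closure_mono ?_ hy
    rintro _ ⟨_, ⟨v, hv, rfl⟩, rfl⟩
    exact ⟨_, ⟨v, hv.1, rfl⟩, rfl⟩
  · rw [mem_sharpClosure, map_inv]
    refine map_mem_closure continuous_inv hy ?_
    rintro _ ⟨_, ⟨v, hv, rfl⟩, rfl⟩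
    refine ⟨_, ⟨v⁻¹, hv.2, rfl⟩, ?_⟩
    rw [← TopRaikov.of_inv, ← map_inv]
    rfl

theorem conj_nhdsOne (x : RaikovCompletion G) :
    Tendsto (fun y => x * y * x⁻¹) (nhdsOne G) (nhdsOne G) := by
  intro s hs
  obtain ⟨U, hU, hUs⟩ := mem_nhdsOne.1 hs
  obtain ⟨V, hV, hVU⟩ := exists_mul_mem hU
  obtain ⟨W, hW, hWV⟩ := exists_mul_mem hV
  have hVWU : ∀ a ∈ V, ∀ b ∈ W, a * b ∈ U := fun a ha b hb =>
    hVU a ha b (by simpa using hWV b hb 1 (mem_of_mem_nhds hW))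
  obtain ⟨g, t, rfl, ht, ht'⟩ := exists_of_mul x hW
  have hg : {y : G | g * y * g⁻¹ ∈ W} ∈ 𝓝 (1 : G) := by
    have : Continuous (fun y : G => g * y * g⁻¹) := by fun_prop
    exact this.continuousAt.preimage_mem_nhds (by simpa using hW)
  refine mem_map.2 (mem_nhdsOne.2 ⟨_, hg, fun y hy => hUs ?_⟩)
  have h1 : of g * y * of g⁻¹ ∈ sharpClosure W :=
    mul_mem_sharpClosure (U := (fun y => g * y) '' {y : G | g * y * g⁻¹ ∈ W}) (V := {g⁻¹})
      (by rintro _ ⟨y, hy, rfl⟩ _ rfl; exact hy)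
      (mul_mem_sharpClosure (U := {g}) (by rintro _ rfl y hy; exact ⟨y, hy, rfl⟩)
        (of_mem_sharpClosure rfl) hy) (of_mem_sharpClosure rfl)
  have h2 := mul_mem_sharpClosure hVWU (mul_mem_sharpClosure hWV ht h1) ht'
  simpa [mul_assoc] using h2

theorem eq_one_of_forall_mem {z : RaikovCompletion G}
    (h : ∀ U ∈ 𝓝 (1 : G), z ∈ sharpClosure U) (h' : ∀ U ∈ 𝓝 (1 : G), z⁻¹ ∈ sharpClosure U) :
    z = 1 := by
  have key : ∀ N ∈ 𝓝 (1 : Coreflection G), toSharp z ∈ closure (TopRaikov.of '' N) := by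
    intro N hN
    obtain ⟨U, hU, hUN⟩ := Coreflection.mem_nhds_one.1 hN
    obtain ⟨V, hV, hVU⟩ := exists_mul_mem hU
    obtain ⟨O, hO, hOV⟩ := (TopRaikov.isDenseInducing_of.nhds_eq_comap (1 : Coreflection G) ▸
      Coreflection.mem_nhds_one.2 ⟨V, hV, subset_rfl⟩ :
        Coreflection.of '' (V ∩ V⁻¹) ∈ comap TopRaikov.of (𝓝 (TopRaikov.of 1)))
    rw [mem_closure_iff_nhds]
    intro M hM
    have hc : Tendsto (fun p : TopRaikov (Coreflection G) × TopRaikov (Coreflection G) =>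
        p.1 * p.2) (𝓝 (toSharp z) ×ˢ 𝓝 (toSharp z⁻¹)) (𝓝 (TopRaikov.of 1)) := by
      have := (continuous_mul (M := TopRaikov (Coreflection G))).tendsto (toSharp z, toSharp z⁻¹)
      rw [nhds_prod_eq, ← map_mul, mul_inv_cancel, map_one] at this
      exact this
    obtain ⟨A, hA, B, hB, hAB⟩ := mem_prod_iff.1 (hc hO)
    obtain ⟨_, ha, _, ⟨g, hg, rfl⟩, rfl⟩ := mem_closure_iff_nhds.1
      (mem_sharpClosure.1 (h V hV)) _ (inter_mem hA hM)
    obtain ⟨_, hb, _, ⟨g', hg', rfl⟩, rfl⟩ := mem_closure_iff_nhds.1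
      (mem_sharpClosure.1 (h' V hV)) _ hB
    have hgg : Coreflection.of (g * g') ∈ TopRaikov.of ⁻¹' O := by
      have := hAB (mk_mem_prod ha.1 hb)
      rw [mem_preimage, map_mul, TopRaikov.of_mul]
      exact this
    obtain ⟨w, hw, hwg⟩ := hOV hgg
    obtain rfl := Coreflection.of.injective hwg
    refine ⟨_, ha.2, _, hUN ⟨g, ⟨?_, ?_⟩, rfl⟩, rfl⟩
    · simpa using hVU g hg 1 (mem_of_mem_nhds hV)
    · have := hVU g' hg' _ hw.2
      simpa using this
  by_contra hz
  have hz' : toSharp z ≠ TopRaikov.of 1 := fun e => hz (toSharp.injective (e.trans (map_one _).symm))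
  have hn : ({toSharp z}ᶜ : Set (TopRaikov (Coreflection G))) ∈ 𝓝 (TopRaikov.of 1) :=
    isOpen_compl_singleton.mem_nhds hz'.symm
  obtain ⟨C, ⟨hC, hCc⟩, hCz⟩ := (closed_nhds_basis _).mem_iff.1 hn
  have := key _ (TopRaikov.continuous_of.continuousAt.preimage_mem_nhds hC)
  exact hCz (hCc.closure_subset_iff.2 (image_preimage_subset _ _) this) rfl

instance : ParatopologicalGroup (RaikovCompletion G) where
  toContinuousMul := by
    refine ContinuousMul.of_nhds_one ?_ ?_ ?_
    · simpa only [nhds_one] using tendsto_mul_nhdsOne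
    · intro x
      rw [nhds_one, nhds_eq]
    · intro x
      rw [nhds_one, nhds_eq]
      refine le_antisymm ?_ ?_
      · have := (tendsto_map (f := fun y => y * x)).comp (conj_nhdsOne x)
        simpa [Function.comp_def, Tendsto] using this
      · have := (tendsto_map (f := fun y => x * y)).comp (conj_nhdsOne x⁻¹)
        simpa [Function.comp_def, Tendsto, mul_assoc] using this
  toT0Space := by
    refine ⟨fun x y hxy => ?_⟩
    have aux : ∀ {x y : RaikovCompletion G}, 𝓝 x = 𝓝 y → ∀ U ∈ 𝓝 (1 : G),
        x⁻¹ * y ∈ sharpClosure U := by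
      intro x y hxy U hU
      have h1 : (fun z => x * z) '' sharpClosure U ∈ 𝓝 y := by
        rw [← hxy, nhds_eq]
        exact image_mem_map (mem_nhdsOne.2 ⟨U, hU, subset_rfl⟩)
      rw [nhds_eq] at h1
      obtain ⟨W, hW, hWs⟩ := mem_nhdsOne.1 (mem_map.1 h1)
      obtain ⟨z, hz, hzy⟩ := hWs (one_mem_sharpClosure hW)
      have : z = x⁻¹ * y := by simpa using congrArg (x⁻¹ * ·) hzy
      exact this ▸ hz
    have h := eq_one_of_forall_mem (aux hxy) (by simpa using aux hxy.symm)
    exact (inv_mul_eq_one.1 h)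

/-- `G` is a topological subgroup of `Ğ`. -/
theorem isEmbedding_of : IsEmbedding (of : G → RaikovCompletion G) := by
  have hind : IsInducing (of : G → RaikovCompletion G) := by
    refine isInducing_iff_nhds.2 fun x => le_antisymm ?_ ?_
    · refine map_le_iff_le_comap.1 fun s hs => ?_
      rw [nhds_eq, mem_map, mem_nhdsOne] at hs
      obtain ⟨U, hU, hUs⟩ := hs
      have : Tendsto (fun y => x⁻¹ * y) (𝓝 x) (𝓝 1) := by
        have h : Continuous (fun y => x⁻¹ * y) := by fun_prop
        simpa using h.tendsto x
      refine mem_map.2 (mem_of_superset (this hU) fun y hy => ?_)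
      simpa [← map_mul] using hUs (of_mem_sharpClosure hy)
    · intro s hs
      have hx : {y | x * y ∈ s} ∈ 𝓝 (1 : G) := by
        have h : Continuous (fun y => x * y) := by fun_prop
        exact h.continuousAt.preimage_mem_nhds (by simpa using hs)
      obtain ⟨V, hV, hVs⟩ := exists_mul_mem hx
      refine mem_comap.2 ⟨(fun z => of x * z) '' sharpClosure V, ?_, ?_⟩
      · rw [nhds_eq]
        exact image_mem_map (mem_nhdsOne.2 ⟨V, hV, subset_rfl⟩)
      · rintro y ⟨z, hz, hzy⟩
        have hz' : z = of (x⁻¹ * y) := by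
          rw [map_mul, map_inv]
          exact eq_inv_mul_of_mul_eq hzy
        rw [hz', mem_sharpClosure] at hz
        have hcl : Coreflection.of (x⁻¹ * y) ∈ closure (Coreflection.of '' V) := by
          rw [TopRaikov.isDenseInducing_of.isInducing.closure_eq_preimage_closure_image,
            mem_preimage]
          refine closure_mono ?_ hz
          rintro _ ⟨_, ⟨v, hv, rfl⟩, rfl⟩
          exact ⟨_, ⟨v, hv, rfl⟩, rfl⟩
        have hN : Coreflection.of '' (V ∩ V⁻¹) ∈ 𝓝 (1 : Coreflection G) :=
          Coreflection.mem_nhds_one.2 ⟨V, hV, subset_rfl⟩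
        have hc : Tendsto (fun c => c⁻¹ * Coreflection.of (x⁻¹ * y))
            (𝓝 (Coreflection.of (x⁻¹ * y))) (𝓝 1) := by
          have h : Continuous (fun c => c⁻¹ * Coreflection.of (x⁻¹ * y)) := by fun_prop
          simpa using h.tendsto (Coreflection.of (x⁻¹ * y))
        obtain ⟨_, ⟨w, hw, hwe⟩, v, hv, rfl⟩ := mem_closure_iff_nhds.1 hcl _ (hc hN)
        have hw' : w = v⁻¹ * (x⁻¹ * y) := Coreflection.of.injective (by simpa using hwe)
        have := hVs v hv w hw.1
        simpa [hw'] using this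
  exact hind.isEmbedding

end RaikovCompletion

end Para

/-! ### `𝒞`-completions -/

set_option linter.checkUnivs false in
/-- A class of continuous homomorphisms between paratopological groups. -/
abbrev ParaHomClass : Type (max (u + 1) (v + 1)) :=
  ∀ (X : Type v) (Y : Type u) [Group X] [TopologicalSpace X] [ParatopologicalGroup X]
    [Group Y] [TopologicalSpace Y] [ParatopologicalGroup Y], Set (X →ₜ* Y)

/-- `Y` is `𝒞`-complete: every homomorphism `h : X → Y` in `𝒞` extends to a continuous
homomorphism from the Raĭkov completion of `X` to `Y`. -/
def IsCComplete (C : ParaHomClass.{u, v}) (Y : Type u) [Group Y] [TopologicalSpace Y]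
    [ParatopologicalGroup Y] : Prop :=
  ∀ (X : Type v) [Group X] [TopologicalSpace X] [ParatopologicalGroup X] (h : X →ₜ* Y),
    h ∈ C X Y → ∃ h' : RaikovCompletion X →ₜ* Y, ∀ x : X, h' (RaikovCompletion.of x) = h x

/-- The `𝒞`-completion of `G`: the intersection of all `𝒞`-complete subgroups of `Ğ` that
contain `G`. -/
noncomputable def cCompletion (C : ParaHomClass.{u, v}) (G : Type u) [Group G] [TopologicalSpace G]
    [ParatopologicalGroup G] : Subgroup (RaikovCompletion G) :=
  sInf {H : Subgroup (RaikovCompletion G) | RaikovCompletion.of.range ≤ H ∧ IsCComplete C H}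

/-! ### Properties of spaces and of paratopological groups -/

/-- Every continuous real-valued function is bounded. -/
def IsPseudocompact (X : Type v) [TopologicalSpace X] : Prop :=
  ∀ f : X → ℝ, Continuous f → Bornology.IsBounded (range f)

/-- For every neighborhood `U` of the identity there is a continuous homomorphism to a Hausdorff
paratopological group of countable pseudocharacter (every point is a `G_δ`) whose kernel is
contained in `U`. -/
def IsProjectivelyPsi (G : Type u) [Group G] [TopologicalSpace G] : Prop :=
  ∀ U ∈ 𝓝 (1 : G), ∃ (Y : Type u) (_ : Group Y) (_ : TopologicalSpace Y)
    (_ : ParatopologicalGroup Y) (h : G →ₜ* Y),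
    T2Space Y ∧ (∀ y : Y, IsGδ {y}) ∧ h ⁻¹' {1} ⊆ U

/-- For every neighborhood `U` of the identity there is a countable family `𝒱` of neighborhoods of
the identity such that every `x` admits `V ∈ 𝒱` with `x V x⁻¹ ⊆ U`. -/
def IsOmegaBalanced (G : Type u) [Group G] [TopologicalSpace G] : Prop :=
  ∀ U ∈ 𝓝 (1 : G), ∃ 𝒱 : Set (Set G), 𝒱.Countable ∧ (∀ V ∈ 𝒱, V ∈ 𝓝 (1 : G)) ∧
    ∀ x : G, ∃ V ∈ 𝒱, (fun v => x * v * x⁻¹) '' V ⊆ U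

/-- The Hausdorff number of a Hausdorff paratopological group: the smallest cardinal `κ ≥ 1` such
that every neighborhood `U` of the identity contains `⋂ α ∈ κ, V α * (V α)⁻¹` for some family of
`κ` neighborhoods of the identity. (Meaningful for Hausdorff `G`, where such `κ` exists.) -/
noncomputable def hausdorffNumber (G : Type u) [Group G] [TopologicalSpace G] : Cardinal.{u} :=
  sInf {κ : Cardinal.{u} | 1 ≤ κ ∧ ∀ U ∈ 𝓝 (1 : G), ∃ V : κ.out → Set G,
    (∀ α, V α ∈ 𝓝 (1 : G)) ∧ (⋂ α, V α * (V α)⁻¹) ⊆ U}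

/-! Let `h : G → Y` be a continuous homomorphism to a group in which the identity is a `G_δ`. It
extends to `map h : Ğ → Y̆`, but the extension need not take values in `Y`. The fiber subgroup of
`h` consists of the points `x` that lie in the closure, taken in the Raĭkov completion of `G^♯`, of
the fiber of `h` over `map h x`. On this subgroup `map h` is `Y`-valued, and a point sent into `V ⊆
Y` lies in the closure of `h⁻¹(V)`.

The crux is that a fiber subgroup is `𝒞`-complete (`extension_mem_fiberSubgroup`). A homomorphism
from a pseudocompact topological group `X` to it extends to `X̆ → Ğ`; compose this with `map h` to
get `ψ`. On `X` the values of `ψ` lie in `Y`, where countably many neighborhoods isolate `1`.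
Pseudocompactness then makes every point `a` of `X̆` a limit of points of `X` at which `ψ` has
exactly the value `ψ a` (`IsPseudocompact.mem_closure_fiber`). Their images lie in the closure of
one fiber of `h`, hence so does the image of `a`. Therefore `𝒞[G]` is contained in every such fiber
subgroup, and `h` extends to `𝒞[G] → Y` with control over the preimages of small sets.

Part 1 follows because these extensions separate the points of `𝒞[G]`. For part 2, a Hausdorff
`ω`-balanced group with `Hs ≤ ω` has, for each neighborhood `U` of the identity, a homomorphism to a
first countable Hausdorff group with some `h⁻¹(V) ⊆ U` (`exists_firstCountable_projection`). This
property passes to `𝒞[G]` by the same extension, and it implies `ω`-balancedness and `Hs ≤ ω`. -/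

/-! ### Pseudocompact spaces and groups -/

/-- In a completely regular pseudocompact space, the closures of the members of a decreasing
sequence of nonempty open sets have a common point. -/
theorem IsPseudocompact.nonempty_iInter_closure {X : Type*} [TopologicalSpace X]
    [CompletelyRegularSpace X] (hX : IsPseudocompact X) {E : ℕ → Set X} (hE : Antitone E)
    (ho : ∀ n, IsOpen (E n)) (hne : ∀ n, (E n).Nonempty) : (⋂ n, closure (E n)).Nonempty := by
  by_contra hempty
  rw [not_nonempty_iff_eq_empty] at hempty
  -- A point outside `closure (E n)` has a neighborhood that misses every `E m` with `m ≥ n`.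
  have hlf : LocallyFinite E := by
    intro x
    have hx : x ∉ ⋂ n, closure (E n) := hempty ▸ notMem_empty x
    obtain ⟨n, hn⟩ : ∃ n, x ∉ closure (E n) := by simpa using hx
    refine ⟨_, isClosed_closure.isOpen_compl.mem_nhds hn,
      (finite_lt_nat n).subset fun m hm => ?_⟩
    obtain ⟨y, hyE, hy⟩ := hm
    by_contra hnm
    exact hy (subset_closure (hE (not_lt.1 hnm) hyE))
  choose p hp using hne
  have hbump : ∀ n, ∃ f : X → ℝ, Continuous f ∧ (∀ x, 0 ≤ f x) ∧ f (p n) = n ∧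
      Function.support f ⊆ E n := by
    intro n
    obtain ⟨f, hf, hf0, hf1⟩ := CompletelyRegularSpace.completely_regular (p n) (E n)ᶜ
      (ho n).isClosed_compl (not_not.2 (hp n))
    refine ⟨fun x => n * (1 - f x), by fun_prop, fun x => ?_, by simp [hf0], fun x hx => ?_⟩
    · exact mul_nonneg n.cast_nonneg (sub_nonneg.2 (f x).2.2)
    · by_contra hxE
      exact hx (by simp [hf1 hxE])
  choose f hf hf0 hfp hfs using hbump
  have hlf' : LocallyFinite fun n => Function.support (f n) := hlf.subset hfs
  -- The sum of the bumps is continuous by local finiteness, and it is at least `n` at `p n`.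
  obtain ⟨c, hc⟩ := (hX _ (continuous_finsum hf hlf')).bddAbove
  obtain ⟨n, hn⟩ := exists_nat_gt c
  have hle : f n (p n) ≤ ∑ᶠ i, f i (p n) :=
    single_le_finsum n (hlf'.point_finite (p n)) fun i => hf0 i (p n)
  have := hc (mem_range_self (p n))
  rw [hfp] at hle
  exact absurd (hle.trans this) (not_le.2 hn)

theorem IsTopologicalGroup.completelyRegularSpace (X : Type*) [Group X] [TopologicalSpace X]
    [IsTopologicalGroup X] : CompletelyRegularSpace X :=
  CompletelyRegularSpace.of_exists_uniformSpace ⟨IsTopologicalGroup.leftUniformSpace X, rfl⟩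

/-- In a regular space, a sequence of neighborhoods of a point can be refined to a sequence of
open neighborhoods each of which contains the closure of the next one. -/
theorem exists_seq_open_nhds_closure_subset {X : Type*} [TopologicalSpace X] [RegularSpace X]
    {x : X} {O : ℕ → Set X} (hO : ∀ n, O n ∈ 𝓝 x) :
    ∃ N : ℕ → Set X, (∀ n, IsOpen (N n)) ∧ (∀ n, x ∈ N n) ∧ (∀ n, closure (N n) ⊆ O n) ∧
      ∀ n, closure (N (n + 1)) ⊆ N n := by
  have step : ∀ s : Set X, s ∈ 𝓝 x → ∃ t : Set X, IsOpen t ∧ x ∈ t ∧ closure t ⊆ s := by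
    intro s hs
    obtain ⟨C, ⟨hC, hCc⟩, hCs⟩ := (closed_nhds_basis x).mem_iff.1 hs
    exact ⟨interior C, isOpen_interior, mem_interior_iff_mem_nhds.2 hC,
      (closure_minimal interior_subset hCc).trans hCs⟩
  choose! S hSo hSx hSs using step
  let N : ℕ → Set X := fun n => Nat.rec (S (O 0)) (fun n t => S (t ∩ O (n + 1))) n
  have hN : ∀ n, IsOpen (N n) ∧ x ∈ N n ∧ closure (N n) ⊆ O n := by
    intro n
    induction n with
    | zero => exact ⟨hSo _ (hO 0), hSx _ (hO 0), hSs _ (hO 0)⟩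
    | succ n ih =>
      have h : N n ∩ O (n + 1) ∈ 𝓝 x := inter_mem (ih.1.mem_nhds ih.2.1) (hO (n + 1))
      exact ⟨hSo _ h, hSx _ h, (hSs _ h).trans inter_subset_right⟩
  refine ⟨N, fun n => (hN n).1, fun n => (hN n).2.1, fun n => (hN n).2.2, fun n => ?_⟩
  exact (hSs _ (inter_mem ((hN n).1.mem_nhds (hN n).2.1) (hO (n + 1)))).trans inter_subset_left

/-- Let `ι : X → A` be a dense continuous homomorphism from a pseudocompact group and `ψ : A → B` a
continuous homomorphism such that countably many neighborhoods of `1` in `B` isolate `1` in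
`ψ (ι X)`. Then every `a : A` is a limit of points of `ι X` at which `ψ` has the value `ψ a`. -/
theorem IsPseudocompact.mem_closure_fiber {X A B : Type*} [Group X] [TopologicalSpace X]
    [IsTopologicalGroup X] (hX : IsPseudocompact X) [Group A] [TopologicalSpace A]
    [IsTopologicalGroup A] [Group B] [TopologicalSpace B] [T3Space B]
    {ι : X → A} (hι : Continuous ι) (hd : DenseRange ι) {ψ : A →* B} (hψ : Continuous ψ)
    {O : ℕ → Set B} (hO : ∀ n, O n ∈ 𝓝 (1 : B))
    (h1 : ∀ x, (∀ n, ψ (ι x) ∈ O n) → ψ (ι x) = 1) (a : A) :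
    a ∈ closure (ι '' {x | ψ (ι x) = ψ a}) := by
  have := IsTopologicalGroup.completelyRegularSpace X
  rw [mem_closure_iff_nhds]
  intro M hM
  have hM1 : (fun t => a * t) ⁻¹' M ∈ 𝓝 (1 : A) :=
    (continuous_const_mul a).continuousAt.preimage_mem_nhds (by simpa using hM)
  have hψ1 : Tendsto ψ (𝓝 1) (𝓝 1) := by simpa using hψ.tendsto 1
  obtain ⟨N, hNo, hN1, hNs, hNN⟩ := exists_seq_open_nhds_closure_subset
    fun n => inter_mem hM1 (hψ1 (hO n))
  have hanti : Antitone N := antitone_nat_of_succ_le fun n => subset_closure.trans (hNN n)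
  -- The images of the `N n` shrink to `1`.
  have hsmall : ∀ F ∈ 𝓝 (1 : B), IsClosed F → ∃ n, closure (N n) ⊆ ψ ⁻¹' F := by
    -- Otherwise the open sets `N n ∩ ψ⁻¹(Fᶜ)` are nonempty and trace on `X` a decreasing sequence
    -- whose closures share a point `c`. Then `ψ (ι c)` lies in every `O n`, so it is `1`; but `ψ`
    -- would have values outside `F` arbitrarily near `c`.
    intro F hF hFc
    by_contra! hcon
    obtain ⟨c, hc⟩ := hX.nonempty_iInter_closure (E := fun n => ι ⁻¹' (N n ∩ ψ ⁻¹' Fᶜ))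
      (fun m n hmn => preimage_mono (inter_subset_inter_left _ (hanti hmn)))
      (fun n => ((hNo n).inter (hFc.isOpen_compl.preimage hψ)).preimage hι) (fun n => by
        have hne : (N n ∩ ψ ⁻¹' Fᶜ).Nonempty := by
          by_contra hne
          refine hcon n (closure_minimal (fun t ht => ?_) (hFc.preimage hψ))
          by_contra htF
          exact hne ⟨t, ht, htF⟩
        exact hd.exists_mem_open ((hNo n).inter (hFc.isOpen_compl.preimage hψ)) hne)
    rw [mem_iInter] at hc
    have hcN : ∀ n, ι c ∈ closure (N n) := fun n =>
      map_mem_closure hι (hc n) fun x hx => hx.1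
    have hc1 : ψ (ι c) = 1 := h1 c fun n => (hNs n (hcN n)).2
    have hFn : (fun x => ψ (ι x)) ⁻¹' F ∈ 𝓝 c :=
      (hψ.comp hι).continuousAt.preimage_mem_nhds (by simpa [hc1] using hF)
    obtain ⟨y, hyF, hy⟩ := mem_closure_iff_nhds.1 (hc 0) _ hFn
    exact hy.2 hyF
  -- Pseudocompactness is used again, for the translates `a * N n`. The hypothesis `h1` does not
  -- apply to `a⁻¹ * ι z`, which need not come from `X`; this is why `hsmall` is needed.
  obtain ⟨z, hz⟩ := hX.nonempty_iInter_closure (E := fun n => ι ⁻¹' ((fun t => a⁻¹ * t) ⁻¹' N n))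
    (fun m n hmn => preimage_mono (preimage_mono (hanti hmn)))
    (fun n => ((hNo n).preimage (continuous_const_mul _)).preimage hι)
    (fun n => hd.exists_mem_open ((hNo n).preimage (continuous_const_mul _))
      ⟨a, show a⁻¹ * a ∈ N n by simpa using hN1 n⟩)
  rw [mem_iInter] at hz
  have hzN : ∀ n, a⁻¹ * ι z ∈ closure (N n) := fun n =>
    map_mem_closure (f := fun x => a⁻¹ * ι x) (by fun_prop) (hz n) fun x hx => hx
  refine ⟨ι z, by simpa using (hNs 0 (hzN 0)).1, z, ?_, rfl⟩
  have hψz : ψ (a⁻¹ * ι z) = 1 := by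
    by_contra hne
    obtain ⟨F, ⟨hF, hFc⟩, hFz⟩ := (closed_nhds_basis (1 : B)).mem_iff.1
      (isOpen_compl_singleton.mem_nhds (Ne.symm hne))
    obtain ⟨n, hn⟩ := hsmall F hF hFc
    exact hFz (hn (hzN n)) rfl
  rw [map_mul, map_inv, inv_mul_eq_one] at hψz
  exact hψz.symm

/-! ### Extension of homomorphisms to Raĭkov completions -/

namespace TopRaikov

variable {A : Type u} {B : Type v} [Group A] [TopologicalSpace A] [IsTopologicalGroup A]
  [Group B] [TopologicalSpace B] [IsTopologicalGroup B]

/-- The uniformity of the Raĭkov completion is coarser than its two-sided uniformity. -/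
theorem exists_nhds_one_of_mem_uniformity {D : Set (TopRaikov B × TopRaikov B)}
    (hD : D ∈ 𝓤 (TopRaikov B)) :
    ∃ M ∈ 𝓝 (1 : TopRaikov B), ∀ a b, a⁻¹ * b ∈ M → b * a⁻¹ ∈ M → (a, b) ∈ D := by
  -- With a closed entourage it suffices to approximate `(a, b)` by pairs from the dense image of
  -- `B`.
  obtain ⟨E, ⟨hE, hEc⟩, hED⟩ := uniformity_hasBasis_closed.mem_iff.1 hD
  let _ := twoSidedUniformSpace B
  have hE' : Prod.map of of ⁻¹' E ∈ 𝓤 B := by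
    rw [← (isUniformInducing_of (H := B)).comap_uniformity]
    exact preimage_mem_comap hE
  obtain ⟨W, hW, hWE⟩ := uniformity_basis_aux.1 hE'
  rw [isDenseInducing_of.nhds_eq_comap] at hW
  obtain ⟨M, hM, hMW⟩ := hW
  obtain ⟨O, hOM, hO, h1O⟩ := mem_nhds_iff.1 hM
  refine ⟨O, hO.mem_nhds h1O, fun a b hab hba => hED ?_⟩
  have hP : {p : TopRaikov B × TopRaikov B | p.1⁻¹ * p.2 ∈ O ∧ p.2 * p.1⁻¹ ∈ O} ∈ 𝓝 (a, b) :=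
    ((hO.preimage (by fun_prop :
      Continuous fun p : TopRaikov B × TopRaikov B => p.1⁻¹ * p.2)).inter
      (hO.preimage (by fun_prop :
        Continuous fun p : TopRaikov B × TopRaikov B => p.2 * p.1⁻¹))).mem_nhds ⟨hab, hba⟩
  refine hEc.closure_subset (mem_closure_iff_nhds.2 fun T hT => ?_)
  obtain ⟨_, hp, ⟨x, y⟩, rfl⟩ := mem_closure_iff_nhds.1
    ((isDenseInducing_of.dense.prodMap isDenseInducing_of.dense) (a, b)) _ (inter_mem hT hP)
  refine ⟨_, hp.1, hWE x y (hMW (hOM ?_)) (hMW (hOM ?_))⟩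
  · rw [of_mul, of_inv]; exact hp.2.1
  · rw [of_mul, of_inv]; exact hp.2.2

/-- Continuous homomorphisms to a Raĭkov completion extend to Raĭkov completions. -/
theorem exists_extension (φ : A →* TopRaikov B) (hφ : Continuous φ) :
    ∃ ψ : TopRaikov A →* TopRaikov B, Continuous ψ ∧ ∀ a, ψ (of a) = φ a := by
  have hcont : Continuous (isDenseInducing_of.extend φ : TopRaikov A → TopRaikov B) := by
    refine isDenseInducing_of.continuous_extend fun x => CompleteSpace.complete ?_
    have hne := isDenseInducing_of.comap_nhds_neBot x
    let _ := twoSidedUniformSpace A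
    have hcauchy : Cauchy (comap of (𝓝 x) : Filter A) :=
      (isUniformInducing_of.cauchy_map_iff).1
        (cauchy_nhds.mono' (by infer_instance) map_comap_le)
    -- A continuous homomorphism preserves two-sided smallness, so it sends Cauchy filters to Cauchy
    -- filters.
    refine ⟨inferInstance, fun D hD => ?_⟩
    obtain ⟨M, hM, hMD⟩ := exists_nhds_one_of_mem_uniformity hD
    have hφM : φ ⁻¹' M ∈ 𝓝 (1 : A) := hφ.continuousAt.preimage_mem_nhds (by simpa using hM)
    obtain ⟨S, hS, h⟩ := (cauchy_iff.1 hcauchy).2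
      {p : A × A | p.1⁻¹ * p.2 ∈ φ ⁻¹' M ∧ p.2 * p.1⁻¹ ∈ φ ⁻¹' M}
      (uniformity_basis_aux.2 ⟨_, hφM, fun x y h1 h2 => ⟨h1, h2⟩⟩)
    refine mem_of_superset (prod_mem_prod (image_mem_map hS) (image_mem_map hS)) ?_
    rintro ⟨_, _⟩ ⟨⟨x, hx, rfl⟩, ⟨y, hy, rfl⟩⟩
    have := h (mk_mem_prod hx hy)
    exact hMD _ _ (by simpa using this.1) (by simpa using this.2)
  have hof : ∀ a, isDenseInducing_of.extend φ (of a) = φ a := isDenseInducing_of.extend_eq hφ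
  refine ⟨MonoidHom.mk' (isDenseInducing_of.extend φ) fun x y => ?_, hcont, hof⟩
  refine isDenseInducing_of.dense.induction_on₂
    (p := fun x y => isDenseInducing_of.extend φ (x * y) =
      isDenseInducing_of.extend φ x * isDenseInducing_of.extend φ y)
    (isClosed_eq (hcont.comp continuous_mul)
      ((hcont.comp continuous_fst).mul (hcont.comp continuous_snd))) (fun a b => ?_) x y
  rw [← of_mul, hof, hof, hof, map_mul]

end TopRaikov

/-- A homomorphism between groups with continuous multiplication is continuous if it is continuous
at the identity. -/
theorem MonoidHom.continuous_of_tendsto_one {A : Type*} {B : Type*} [Group A] [TopologicalSpace A]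
    [ContinuousMul A] [Group B] [TopologicalSpace B] [ContinuousMul B] (f : A →* B)
    (hf : Tendsto f (𝓝 1) (𝓝 1)) : Continuous f := by
  refine continuous_iff_continuousAt.2 fun x => ?_
  have h1 : Tendsto (fun y => x⁻¹ * y) (𝓝 x) (𝓝 1) := by
    simpa using (continuous_const_mul x⁻¹).tendsto x
  have h2 : Tendsto (fun y => f x * y) (𝓝 1) (𝓝 (f x)) := by
    simpa using (continuous_const_mul (f x)).tendsto 1
  refine (h2.comp (hf.comp h1)).congr fun y => ?_
  simp

namespace RaikovCompletion

variable {A : Type u} {B : Type v} [Group A] [TopologicalSpace A] [ParatopologicalGroup A]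
  [Group B] [TopologicalSpace B] [ParatopologicalGroup B]

theorem sharpClosure_mem_nhds {U : Set B} (hU : U ∈ 𝓝 (1 : B)) :
    sharpClosure U ∈ 𝓝 (1 : RaikovCompletion B) :=
  nhds_one (G := B) ▸ mem_nhdsOne.2 ⟨U, hU, subset_rfl⟩

/-- The topology of the Raĭkov completion of `B^♯` is finer than that of `B̆`. -/
theorem continuous_toSharp_symm :
    Continuous (toSharp.symm : TopRaikov (Coreflection B) → RaikovCompletion B) := by
  refine (toSharp.symm : TopRaikov (Coreflection B) ≃* RaikovCompletion B).toMonoidHom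
    |>.continuous_of_tendsto_one fun s hs => ?_
  rw [nhds_one] at hs
  obtain ⟨U, hU, hUs⟩ := mem_nhdsOne.1 hs
  have hN := TopRaikov.isDenseInducing_of.closure_image_mem_nhds
    (Coreflection.mem_nhds_one.2 ⟨U, hU, subset_rfl⟩)
  refine mem_map.2 (mem_of_superset hN fun y hy => hUs ?_)
  refine closure_mono (X := TopRaikov (Coreflection B)) ?_ hy
  rintro _ ⟨_, ⟨v, hv, rfl⟩, rfl⟩
  exact ⟨_, ⟨v, hv.1, rfl⟩, rfl⟩

/-- The sets `cl U ∩ (cl U)⁻¹` are small in the Raĭkov completion of `B^♯`. -/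
theorem exists_sharpClosure_subset {M : Set (TopRaikov (Coreflection B))}
    (hM : M ∈ 𝓝 (1 : TopRaikov (Coreflection B))) :
    ∃ U ∈ 𝓝 (1 : B), ∀ z : RaikovCompletion B, z ∈ sharpClosure U → z⁻¹ ∈ sharpClosure U →
      toSharp z ∈ M := by
  obtain ⟨F, ⟨hF, hFc⟩, hFM⟩ := (closed_nhds_basis _).mem_iff.1 hM
  obtain ⟨U, hU, hUF⟩ := Coreflection.mem_nhds_one.1
    (TopRaikov.continuous_of.continuousAt.preimage_mem_nhds hF)
  obtain ⟨V, hV, hVU⟩ := exists_mul_mem hU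
  obtain ⟨O, hO, hOV⟩ := (TopRaikov.isDenseInducing_of.nhds_eq_comap (1 : Coreflection B) ▸
    Coreflection.mem_nhds_one.2 ⟨V, hV, subset_rfl⟩ :
      Coreflection.of '' (V ∩ V⁻¹) ∈ comap TopRaikov.of (𝓝 (TopRaikov.of 1)))
  refine ⟨V, hV, fun z hz hz' => hFM (hFc.closure_subset (mem_closure_iff_nhds.2 fun T hT => ?_))⟩
  have hc : Tendsto (fun p : TopRaikov (Coreflection B) × TopRaikov (Coreflection B) =>
      p.1 * p.2) (𝓝 (toSharp z) ×ˢ 𝓝 (toSharp z⁻¹)) (𝓝 (TopRaikov.of 1)) := by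
    have := (continuous_mul (M := TopRaikov (Coreflection B))).tendsto (toSharp z, toSharp z⁻¹)
    rw [nhds_prod_eq, ← map_mul, mul_inv_cancel, map_one] at this
    exact this
  -- Approximate `z` and `z⁻¹` separately by `g, g' ∈ V` so closely that `w = g * g'` lies in `V ∩
  -- V⁻¹`. Then `g⁻¹ = g' * w⁻¹ ∈ V * V ⊆ U`, so `g ∈ U ∩ U⁻¹`.
  obtain ⟨P, hP, Q, hQ, hPQ⟩ := mem_prod_iff.1 (hc hO)
  obtain ⟨_, ha, _, ⟨g, hg, rfl⟩, rfl⟩ := mem_closure_iff_nhds.1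
    (mem_sharpClosure.1 hz) _ (inter_mem hP hT)
  obtain ⟨_, hb, _, ⟨g', hg', rfl⟩, rfl⟩ := mem_closure_iff_nhds.1
    (mem_sharpClosure.1 hz') _ hQ
  have hgg : Coreflection.of (g * g') ∈ TopRaikov.of ⁻¹' O := by
    have := hPQ (mk_mem_prod ha.1 hb)
    rw [mem_preimage, map_mul, TopRaikov.of_mul]
    exact this
  obtain ⟨w, hw, hwg⟩ := hOV hgg
  obtain rfl := Coreflection.of.injective hwg
  refine ⟨_, ha.2, hUF ⟨g, ⟨?_, ?_⟩, rfl⟩⟩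
  · simpa using hVU g hg 1 (mem_of_mem_nhds hV)
  · simpa using hVU g' hg' _ hw.2

/-- A continuous homomorphism `A → B̆` is continuous from `A^♯` to the Raĭkov completion
of `B^♯`. -/
theorem continuous_toSharp_comp (φ : A →ₜ* RaikovCompletion B) :
    Continuous fun a : Coreflection A => toSharp (φ (Coreflection.of.symm a)) := by
  refine ((toSharp.toMonoidHom.comp φ.toMonoidHom).comp
    (Coreflection.of (G := A)).symm.toMonoidHom).continuous_of_tendsto_one fun M hM => ?_
  obtain ⟨U, hU, hUM⟩ := exists_sharpClosure_subset hM
  have hV : φ ⁻¹' sharpClosure U ∈ 𝓝 (1 : A) :=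
    φ.continuous_toFun.continuousAt.preimage_mem_nhds (by
      change _ ∈ 𝓝 (φ 1)
      simpa using sharpClosure_mem_nhds hU)
  refine mem_map.2 (Coreflection.mem_nhds_one.2 ⟨_, hV, ?_⟩)
  rintro _ ⟨x, ⟨hx, hx'⟩, rfl⟩
  refine hUM _ hx ?_
  have : φ x⁻¹ ∈ sharpClosure U := hx'
  rwa [map_inv] at this

/-- Continuous homomorphisms to a Raĭkov completion extend to Raĭkov completions. -/
theorem exists_extension (φ : A →ₜ* RaikovCompletion B) :
    ∃ ψ : RaikovCompletion A →ₜ* RaikovCompletion B,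
      Continuous (fun x => toSharp (ψ (toSharp.symm x))) ∧ ∀ a, ψ (of a) = φ a := by
  obtain ⟨ψ, hψ, hψφ⟩ := TopRaikov.exists_extension
    ((toSharp.toMonoidHom.comp φ.toMonoidHom).comp (Coreflection.of (G := A)).symm.toMonoidHom)
    (continuous_toSharp_comp φ)
  have hof : ∀ a, ψ (toSharp (of a)) = toSharp (φ a) := fun a => hψφ (Coreflection.of a)
  let ψ' : RaikovCompletion A →* RaikovCompletion B :=
    (toSharp.symm.toMonoidHom.comp ψ).comp toSharp.toMonoidHom
  have hψ' : Continuous ψ' := by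
    refine ψ'.continuous_of_tendsto_one fun s hs => ?_
    rw [nhds_one] at hs
    obtain ⟨U, hU, hUs⟩ := mem_nhdsOne.1 hs
    have hV : φ ⁻¹' sharpClosure U ∈ 𝓝 (1 : A) :=
      φ.continuous_toFun.continuousAt.preimage_mem_nhds (by
        change _ ∈ 𝓝 (φ 1)
        simpa using sharpClosure_mem_nhds hU)
    refine mem_map.2 (mem_of_superset (sharpClosure_mem_nhds hV) fun x hx => hUs ?_)
    -- Basic neighborhoods in `Ă` and `B̆` are closures for the finer topologies, so continuity of
    -- `ψ` for the latter gives continuity for the coarser ones.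
    have key : ψ (toSharp x) ∈ closure (closure (toSharp '' (of '' U))) := by
      refine map_mem_closure hψ (mem_sharpClosure.1 hx) ?_
      rintro _ ⟨_, ⟨a, ha, rfl⟩, rfl⟩
      rw [hof]
      exact ha
    rwa [closure_closure] at key
  exact ⟨⟨ψ', hψ'⟩, hψ, fun a => toSharp.injective (hof a)⟩

end RaikovCompletion

/-! ### Fiber subgroups and their `𝒞`-completeness -/

namespace RaikovCompletion

variable {A : Type u} {B : Type v} [Group A] [TopologicalSpace A] [ParatopologicalGroup A]
  [Group B] [TopologicalSpace B] [ParatopologicalGroup B]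

/-- The extension `Ă → B̆` of a continuous homomorphism `A → B`. -/
noncomputable def map (h : A →ₜ* B) : RaikovCompletion A →ₜ* RaikovCompletion B :=
  (exists_extension ((⟨of, isEmbedding_of.continuous⟩ : B →ₜ* RaikovCompletion B).comp h)).choose

/-- Fibers are closed up in the Raĭkov completion of `A^♯`, so continuity for the finer topologies
is needed besides continuity `Ă → B̆`. -/
theorem continuous_toSharp_map (h : A →ₜ* B) :
    Continuous fun x => toSharp (map h (toSharp.symm x)) :=
  (exists_extension
    ((⟨of, isEmbedding_of.continuous⟩ : B →ₜ* RaikovCompletion B).comp h)).choose_spec.1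

theorem map_of (h : A →ₜ* B) (a : A) : map h (of a) = of (h a) :=
  (exists_extension
    ((⟨of, isEmbedding_of.continuous⟩ : B →ₜ* RaikovCompletion B).comp h)).choose_spec.2 a

/-- The points `x` of `Ă` that are limits in the Raĭkov completion of `A^♯` of points of `A`
having the same image in `B̆` as `x`. In particular the image of `x` lies in `B`. -/
noncomputable def fiberSubgroup (h : A →ₜ* B) : Subgroup (RaikovCompletion A) where
  carrier := {x | x ∈ sharpClosure {a : A | of (h a) = map h x}}
  one_mem' := by
    have : (1 : A) ∈ {a : A | of (h a) = map h 1} := by simp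
    simpa using of_mem_sharpClosure this
  mul_mem' {x y} hx hy := by
    have h' : ∀ a ∈ {a : A | of (h a) = map h x}, ∀ b ∈ {a : A | of (h a) = map h y},
        a * b ∈ {a : A | of (h a) = map h (x * y)} := by
      intro a ha b hb
      rw [mem_ofPred_eq] at ha hb ⊢
      rw [map_mul h, map_mul of, ha, hb, map_mul (map h)]
    exact mul_mem_sharpClosure h' hx hy
  inv_mem' {x} hx := by
    rw [mem_ofPred_eq, mem_sharpClosure] at hx ⊢
    rw [map_inv toSharp]
    refine map_mem_closure continuous_inv hx ?_
    rintro _ ⟨_, ⟨a, ha, rfl⟩, rfl⟩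
    refine ⟨_, ⟨a⁻¹, ?_, rfl⟩, by rw [map_inv of, map_inv toSharp]⟩
    rw [mem_ofPred_eq] at ha ⊢
    rw [map_inv h, map_inv of, ha, map_inv (map h)]

theorem mem_fiberSubgroup {h : A →ₜ* B} {x : RaikovCompletion A} :
    x ∈ fiberSubgroup h ↔ x ∈ sharpClosure {a : A | of (h a) = map h x} := Iff.rfl

theorem of_mem_fiberSubgroup (h : A →ₜ* B) (a : A) : of a ∈ fiberSubgroup h :=
  of_mem_sharpClosure (map_of h a).symm

theorem exists_of_eq_map {h : A →ₜ* B} {x : RaikovCompletion A} (hx : x ∈ fiberSubgroup h) :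
    ∃ b : B, of b = map h x := by
  obtain ⟨_, _, ⟨_, ⟨a, ha, rfl⟩, rfl⟩⟩ := mem_closure_iff_nhds.1 (mem_sharpClosure.1 hx) _ univ_mem
  exact ⟨h a, ha⟩

/-- The continuous homomorphism to `B` that `h : A → B` induces on a subgroup of its fiber
subgroup. -/
noncomputable def restrictFiber (h : A →ₜ* B) {K : Subgroup (RaikovCompletion A)}
    (hK : K ≤ fiberSubgroup h) : K →ₜ* B where
  toMonoidHom := MonoidHom.mk' (fun x => (exists_of_eq_map (hK x.2)).choose) fun x y => by
    apply isEmbedding_of.injective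
    rw [map_mul, (exists_of_eq_map (hK (x * y).2)).choose_spec,
      (exists_of_eq_map (hK x.2)).choose_spec, (exists_of_eq_map (hK y.2)).choose_spec]
    exact map_mul (map h) _ _
  continuous_toFun := isEmbedding_of.continuous_iff.2 <|
    ((map h).continuous_toFun.comp continuous_subtype_val).congr fun x =>
      (exists_of_eq_map (hK x.2)).choose_spec.symm

theorem of_restrictFiber (h : A →ₜ* B) {K : Subgroup (RaikovCompletion A)}
    (hK : K ≤ fiberSubgroup h) (x : K) : of (restrictFiber h hK x) = map h x :=
  (exists_of_eq_map (hK x.2)).choose_spec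

/-- The fiber of `h` whose closure contains `x` lies entirely in `h⁻¹(V)`. This bounds preimages
under the extended homomorphism by basic neighborhoods of `Ă`, which the mere inclusion of `map h x`
in `B` would not give. -/
theorem mem_sharpClosure_of_restrictFiber_mem (h : A →ₜ* B) {K : Subgroup (RaikovCompletion A)}
    (hK : K ≤ fiberSubgroup h) {x : K} {V : Set B} (hx : restrictFiber h hK x ∈ V) :
    (x : RaikovCompletion A) ∈ sharpClosure (h ⁻¹' V) := by
  refine sharpClosure_mono (fun a ha => ?_) (mem_fiberSubgroup.1 (hK x.2))
  rw [mem_ofPred_eq, ← of_restrictFiber h hK] at ha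
  rw [mem_preimage, isEmbedding_of.injective ha]
  exact hx

/-- The extension to `X̆` of a continuous homomorphism from a pseudocompact topological group `X` to
a fiber subgroup takes values in that fiber subgroup. -/
theorem extension_mem_fiberSubgroup {X : Type*} [Group X] [TopologicalSpace X]
    [ParatopologicalGroup X] [IsTopologicalGroup X] (hX : IsPseudocompact X)
    {h : A →ₜ* B} (hB : IsGδ {(1 : B)}) {f : RaikovCompletion X →ₜ* RaikovCompletion A}
    (hf : Continuous fun x => toSharp (f (toSharp.symm x)))
    (hfX : ∀ x : X, f (of x) ∈ fiberSubgroup h) (x : RaikovCompletion X) :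
    f x ∈ fiberSubgroup h := by
  let ψ : TopRaikov (Coreflection X) →* TopRaikov (Coreflection B) :=
    ((toSharp.toMonoidHom.comp (map h).toMonoidHom).comp f.toMonoidHom).comp
      toSharp.symm.toMonoidHom
  have hψ : Continuous ψ := (continuous_toSharp_map h).comp hf
  have hι : Continuous fun y : X => toSharp (of y) := by
    refine TopRaikov.continuous_of.comp (continuous_induced_rng.2 ?_)
    exact continuous_id.prodMk continuous_inv
  have hd : DenseRange fun y : X => toSharp (of y) :=
    TopRaikov.isDenseInducing_of.dense.comp Coreflection.of.surjective.denseRange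
      TopRaikov.continuous_of
  -- The open sets `O n` are traces on `B` of open sets `P n` of `B̆`. The `P n` need not isolate
  -- `1` in `B̆`, but they do among the values of `ψ` on `X`, which lie in `B`.
  obtain ⟨O, hO, hO1⟩ := isGδ_iff_eq_iInter_nat.1 hB
  have hO' : ∀ n, ∃ P : Set (RaikovCompletion B), IsOpen P ∧ of ⁻¹' P = O n := fun n =>
    isEmbedding_of.isInducing.isOpen_iff.1 (hO n)
  choose P hP hPO using hO'
  have key := hX.mem_closure_fiber hι hd hψ (O := fun n => toSharp.symm ⁻¹' P n)
    (fun n => ((hP n).preimage continuous_toSharp_symm).mem_nhds (by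
      have : (1 : B) ∈ of ⁻¹' P n := by
        rw [hPO]
        exact mem_iInter.1 (hO1 ▸ mem_singleton (1 : B)) n
      simpa using this))
    (fun y hy => by
      obtain ⟨b, hb⟩ := exists_of_eq_map (hfX y)
      have hψb : ψ (toSharp (of y)) = toSharp (of b) := congrArg toSharp hb.symm
      have hb1 : b ∈ ({1} : Set B) := by
        rw [hO1, mem_iInter]
        intro n
        rw [← hPO, mem_preimage]
        have := hy n
        rwa [hψb] at this
      rw [hψb, mem_singleton_iff.1 hb1, map_one, map_one])
    (toSharp x)
  -- The point `f x` is a limit of points `f (of y)` with the same image under `map h`, each in the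
  -- closure of the same fiber of `h`.
  have hfx : toSharp (f x) ∈
      closure (closure (toSharp '' (of '' {a : A | of (h a) = map h (f x)}))) := by
    refine map_mem_closure (f := fun x => toSharp (f (toSharp.symm x))) hf key ?_
    rintro _ ⟨y, hy, rfl⟩
    have hy' : map h (f (of y)) = map h (f x) := toSharp.injective hy
    have := hfX y
    rw [mem_fiberSubgroup, hy'] at this
    exact this
  rwa [closure_closure] at hfx

end RaikovCompletion

open RaikovCompletion in
/-- For a class `C` of homomorphisms from pseudocompact topological groups, the `C`-completion is
contained in the fiber subgroup of each homomorphism to a group of countable pseudocharacter. -/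
theorem cCompletion_le_fiberSubgroup {C : ParaHomClass.{u, v}}
    (hC : ∀ (X : Type v) (Y : Type u) [Group X] [TopologicalSpace X] [ParatopologicalGroup X]
      [Group Y] [TopologicalSpace Y] [ParatopologicalGroup Y] (h : X →ₜ* Y),
      h ∈ C X Y → IsTopologicalGroup X ∧ IsPseudocompact X)
    {G Y : Type u} [Group G] [TopologicalSpace G] [ParatopologicalGroup G]
    [Group Y] [TopologicalSpace Y] [ParatopologicalGroup Y] (h : G →ₜ* Y)
    (hY : IsGδ {(1 : Y)}) : cCompletion C G ≤ fiberSubgroup h := by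
  refine sInf_le ⟨?_, ?_⟩
  · rintro _ ⟨g, rfl⟩
    exact of_mem_fiberSubgroup h g
  · intro X _ _ _ f hfC
    obtain ⟨_, hX⟩ := hC X _ f hfC
    obtain ⟨f', hf', hext⟩ := exists_extension
      ((⟨(fiberSubgroup h).subtype, continuous_subtype_val⟩ :
        fiberSubgroup h →ₜ* RaikovCompletion G).comp f)
    have hmem : ∀ x, f' x ∈ fiberSubgroup h := extension_mem_fiberSubgroup hX hY hf' fun x => by
      rw [hext]
      exact (f x).2
    exact ⟨⟨f'.toMonoidHom.codRestrict _ hmem, f'.continuous_toFun.subtype_mk hmem⟩,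
      fun x => Subtype.ext (hext x)⟩

/-! ### Hausdorff number at most `ω` -/

/-- For a Hausdorff paratopological group, `Hs(G) ≤ ω` provides countable families. -/
theorem exists_countable_of_hausdorffNumber_le {G : Type u} [Group G] [TopologicalSpace G]
    [ContinuousMul G] [T2Space G] (h : hausdorffNumber G ≤ ℵ₀) {U : Set G}
    (hU : U ∈ 𝓝 (1 : G)) :
    ∃ 𝒱 : Set (Set G), 𝒱.Countable ∧ (∀ V ∈ 𝒱, V ∈ 𝓝 (1 : G)) ∧ (⋂ V ∈ 𝒱, V * V⁻¹) ⊆ U := by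
  -- The infimum of an empty set of cardinals would be `0`, so nonemptiness is needed for it to be
  -- attained. In a Hausdorff group the family of all neighborhoods of `1` is a witness.
  have hne : {κ : Cardinal.{u} | 1 ≤ κ ∧ ∀ U ∈ 𝓝 (1 : G), ∃ V : κ.out → Set G,
      (∀ α, V α ∈ 𝓝 (1 : G)) ∧ (⋂ α, V α * (V α)⁻¹) ⊆ U}.Nonempty := by
    have : Nonempty {V : Set G // V ∈ 𝓝 (1 : G)} := ⟨⟨univ, univ_mem⟩⟩
    refine ⟨#{V : Set G // V ∈ 𝓝 (1 : G)}, Cardinal.one_le_iff_ne_zero.2 (Cardinal.mk_ne_zero _),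
      fun U hU => ?_⟩
    refine ⟨fun α => (Cardinal.outMkEquiv α).1, fun α => (Cardinal.outMkEquiv α).2, fun x hx => ?_⟩
    suffices hx1 : x = 1 from hx1 ▸ mem_of_mem_nhds hU
    by_contra hx1
    obtain ⟨P, Q, hP, hQ, hxP, hQ1, hPQ⟩ := t2_separation hx1
    have hP' : (fun y => x * y) ⁻¹' P ∈ 𝓝 (1 : G) :=
      (continuous_const_mul x).continuousAt.preimage_mem_nhds (by simpa using hP.mem_nhds hxP)
    have hV := inter_mem hP' (hQ.mem_nhds hQ1)
    have := mem_iInter.1 hx (Cardinal.outMkEquiv.symm ⟨_, hV⟩)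
    simp only [Equiv.apply_symm_apply] at this
    obtain ⟨a, ha, b, hb, hab⟩ := this
    refine disjoint_left.1 hPQ hb.1 ?_
    have hab' : a * b = x := hab
    rw [← hab']
    simpa using ha.2
  obtain ⟨-, hκ⟩ := csInf_mem hne
  obtain ⟨V, hV, hVU⟩ := hκ U hU
  have hcount : Countable (hausdorffNumber G).out := by
    rw [← Cardinal.mk_le_aleph0_iff, Cardinal.mk_out]
    exact h
  refine ⟨range V, countable_range (ι := (hausdorffNumber G).out) V, ?_, ?_⟩
  · rintro _ ⟨α, rfl⟩
    exact hV α
  · simpa using hVU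

theorem hausdorffNumber_le_aleph0 {G : Type u} [Group G] [TopologicalSpace G]
    (h : ∀ U ∈ 𝓝 (1 : G), ∃ V : ℕ → Set G, (∀ n, V n ∈ 𝓝 (1 : G)) ∧ (⋂ n, V n * (V n)⁻¹) ⊆ U) :
    hausdorffNumber G ≤ ℵ₀ := by
  refine csInf_le' ⟨Cardinal.one_le_aleph0, fun U hU => ?_⟩
  obtain ⟨V, hV, hVU⟩ := h U hU
  obtain ⟨e⟩ : Nonempty ((ℵ₀ : Cardinal.{u}).out ≃ ℕ) := by
    rw [← Cardinal.lift_mk_eq', Cardinal.mk_out]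
    simp
  refine ⟨fun α => V (e α), fun α => hV _, ?_⟩
  rwa [e.surjective.iInter_comp (g := fun n => V n * (V n)⁻¹)]

/-! ### Projections onto first countable Hausdorff groups -/

/-- The Hausdorff quotient of a first countable group `K` with continuous multiplication in which
the sets `V * V⁻¹` have the same intersection as the neighborhoods of the identity. -/
theorem exists_hausdorff_quotient {K : Type u} [Group K] [TopologicalSpace K] [ContinuousMul K]
    [(𝓝 (1 : K)).IsCountablyGenerated]
    (hK : ∀ U ∈ 𝓝 (1 : K), ∀ x, (∀ V ∈ 𝓝 (1 : K), x ∈ V * V⁻¹) → x ∈ U) :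
    ∃ (Y : Type u) (_ : Group Y) (_ : TopologicalSpace Y) (_ : ParatopologicalGroup Y)
      (h : K →ₜ* Y), T2Space Y ∧ FirstCountableTopology Y ∧
        ∀ U ∈ 𝓝 (1 : K), ∃ V ∈ 𝓝 (1 : Y), h ⁻¹' V ⊆ U := by
  have hmul : ∀ U ∈ 𝓝 (1 : K), ∃ V ∈ 𝓝 (1 : K), ∀ x ∈ V, ∀ y ∈ V, x * y ∈ U := by
    intro U hU
    obtain ⟨V, hV, h1, h⟩ := exists_open_nhds_one_mul_subset hU
    exact ⟨V, hV.mem_nhds h1, fun x hx y hy => h (mul_mem_mul hx hy)⟩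
  let N : Subgroup K :=
    { carrier := {x | ∀ U ∈ 𝓝 (1 : K), x ∈ U}
      one_mem' := fun U hU => mem_of_mem_nhds hU
      mul_mem' := fun {x y} hx hy U hU => by
        obtain ⟨V, hV, hVU⟩ := hmul U hU
        exact hVU x (hx V hV) y (hy V hV)
      -- Closure under inverses is where `hK` enters: `x⁻¹ = 1 * x⁻¹` lies in every `V * V⁻¹`.
      inv_mem' := fun {x} hx U hU => hK U hU _ fun V hV =>
        ⟨1, mem_of_mem_nhds hV, x⁻¹, inv_mem_inv.2 (hx V hV), one_mul _⟩ }
  have hN : N.Normal := ⟨fun x hx g U hU =>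
    hx ((fun y => g * y * g⁻¹) ⁻¹' U) ((by fun_prop : Continuous fun y => g * y * g⁻¹).continuousAt
      |>.preimage_mem_nhds (by simpa using hU))⟩
  have hcm : ContinuousMul (K ⧸ N) := by
    refine ⟨?_⟩
    have hq : IsOpenQuotientMap
        (Prod.map (QuotientGroup.mk (s := N)) (QuotientGroup.mk (s := N))) :=
      QuotientGroup.isOpenQuotientMap_mk.prodMap QuotientGroup.isOpenQuotientMap_mk
    exact hq.isQuotientMap.continuous_iff.2 (QuotientGroup.continuous_mk.comp continuous_mul)
  have hsep : ∀ a b : K, a⁻¹ * b ∉ N → ∃ V ∈ 𝓝 (1 : K), ∀ v ∈ V, ∀ w ∈ V,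
      (a * v)⁻¹ * (b * w) ∉ N := by
    intro a b hab
    obtain ⟨U, hU, habU⟩ : ∃ U ∈ 𝓝 (1 : K), a⁻¹ * b ∉ U := by
      by_contra! hcon
      exact hab hcon
    obtain ⟨V, hV, habV⟩ : ∃ V ∈ 𝓝 (1 : K), a⁻¹ * b ∉ V * V⁻¹ := by
      by_contra! hcon
      exact habU (hK U hU _ hcon)
    obtain ⟨W, hW, hWV⟩ := hmul V hV
    -- If `n = (a * v)⁻¹ * (b * w)` were in `N ⊆ W`, then `a⁻¹ * b = (v * n) * w⁻¹` would lie in `V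
    -- * V⁻¹`.
    refine ⟨W, hW, fun v hv w hw hn => habV ⟨v * ((a * v)⁻¹ * (b * w)), hWV v hv _ (hn W hW), w⁻¹,
      inv_mem_inv.2 ?_, ?_⟩⟩
    · simpa using hWV w hw 1 (mem_of_mem_nhds hW)
    · change v * ((a * v)⁻¹ * (b * w)) * w⁻¹ = a⁻¹ * b
      group
  have ht2 : T2Space (K ⧸ N) := by
    refine t2Space_iff_disjoint_nhds.2 fun p q => ?_
    induction p using QuotientGroup.induction_on with | H a => ?_
    induction q using QuotientGroup.induction_on with | H b => ?_
    intro hab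
    obtain ⟨V, hV, hVab⟩ := hsep a b fun h => hab (QuotientGroup.eq.2 h)
    have hnhds : ∀ c : K, (fun y => c * y) '' V ∈ 𝓝 c := fun c => by
      have : (fun y => c⁻¹ * y) ⁻¹' V ∈ 𝓝 c :=
        (continuous_const_mul c⁻¹).continuousAt.preimage_mem_nhds (by simpa using hV)
      exact mem_of_superset this fun y hy => ⟨_, hy, by simp⟩
    rw [QuotientGroup.nhds_eq, QuotientGroup.nhds_eq]
    refine Filter.disjoint_iff.2 ⟨_, image_mem_map (hnhds a), _, image_mem_map (hnhds b), ?_⟩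
    rw [disjoint_left]
    rintro _ ⟨_, ⟨v, hv, rfl⟩, rfl⟩ ⟨_, ⟨w, hw, rfl⟩, hvw⟩
    exact hVab v hv w hw (QuotientGroup.eq.1 hvw.symm)
  refine ⟨K ⧸ N, inferInstance, inferInstance,
    { toContinuousMul := hcm, toT0Space := inferInstance },
    ⟨QuotientGroup.mk' N, QuotientGroup.continuous_mk⟩, ht2, ⟨fun p => ?_⟩, fun U hU => ?_⟩
  · induction p using QuotientGroup.induction_on with | H a => ?_
    have ha : 𝓝 a = map (fun y => a * y) (𝓝 1) := by
      simpa using ((Homeomorph.mulLeft a).map_nhds_eq 1).symm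
    rw [QuotientGroup.nhds_eq, ha]
    infer_instance
  · obtain ⟨V, hV, hVU⟩ := hmul U hU
    -- The preimage of the image of `V` is `V * N`, which lies in `V * V ⊆ U` because `N ⊆ V`.
    refine ⟨_, (QuotientGroup.nhds_eq N 1).symm ▸ image_mem_map hV, ?_⟩
    rintro x ⟨v, hv, hvx⟩
    have hn : v⁻¹ * x ∈ N := QuotientGroup.eq.1 hvx
    simpa using hVU v hv _ (hn V hV)

/-- A countable family of sets that contains a given set and is closed under an operation assigning
to each set countably many sets. -/
theorem exists_countable_closed_family {α : Type*} {p : α → Prop} (Φ : α → Set α)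
    (hΦ : ∀ a, p a → (Φ a).Countable ∧ ∀ b ∈ Φ a, p b) {a : α} (ha : p a) :
    ∃ γ : Set α, γ.Countable ∧ a ∈ γ ∧ (∀ b ∈ γ, p b) ∧ ∀ b ∈ γ, Φ b ⊆ γ := by
  let S : ℕ → Set α := fun n => Nat.rec {a} (fun _ s => ⋃ b ∈ s, Φ b) n
  have hS : ∀ n, (S n).Countable ∧ ∀ b ∈ S n, p b := by
    intro n
    induction n with
    | zero => exact ⟨countable_singleton a, fun b hb => mem_singleton_iff.1 hb ▸ ha⟩
    | succ n ih =>
      refine ⟨ih.1.biUnion fun b hb => (hΦ b (ih.2 b hb)).1, fun b hb => ?_⟩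
      obtain ⟨c, hc, hbc⟩ := mem_iUnion₂.1 hb
      exact (hΦ c (ih.2 c hc)).2 b hbc
  refine ⟨⋃ n, S n, countable_iUnion fun n => (hS n).1, mem_iUnion.2 ⟨0, rfl⟩, fun b hb => ?_,
    fun b hb => ?_⟩
  · obtain ⟨n, hn⟩ := mem_iUnion.1 hb
    exact (hS n).2 b hn
  · obtain ⟨n, hn⟩ := mem_iUnion.1 hb
    exact fun c hc => mem_iUnion.2 ⟨n + 1, mem_iUnion₂.2 ⟨b, hn, hc⟩⟩

/-- A filter at the identity that is compatible with multiplication and invariant under conjugation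
is the neighborhood filter of the identity for a topology with continuous multiplication. -/
theorem exists_topology_of_nhds_one {G : Type*} [Group G] (𝓕 : Filter G) (h1 : pure 1 ≤ 𝓕)
    (hmul : Tendsto (Function.uncurry ((· * ·) : G → G → G)) (𝓕 ×ˢ 𝓕) 𝓕)
    (hconj : ∀ x : G, Tendsto (fun y => x * y * x⁻¹) 𝓕 𝓕) :
    ∃ t : TopologicalSpace G, @ContinuousMul G t _ ∧ @nhds G t 1 = 𝓕 := by
  let t : TopologicalSpace G := TopologicalSpace.mkOfNhds fun x => map (fun y => x * y) 𝓕
  have hnhds : ∀ x : G, 𝓝 x = map (fun y => x * y) 𝓕 := by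
    intro x
    refine TopologicalSpace.nhds_mkOfNhds _ x (fun a s hs => ?_) fun a s hs => ?_
    · have := h1 (mem_map.1 hs)
      simpa using this
    · have := hmul (mem_map.1 hs)
      obtain ⟨P, hP, Q, hQ, hPQ⟩ := mem_prod_iff.1 this
      refine mem_map.2 (mem_of_superset hP fun y hy =>
        mem_map.2 (mem_of_superset hQ fun z hz => ?_))
      have := hPQ (mk_mem_prod hy hz)
      simpa [mul_assoc] using this
  have hone : 𝓝 (1 : G) = 𝓕 := by simp [hnhds]
  refine ⟨t, ContinuousMul.of_nhds_one (by rwa [hone]) (fun x => by rw [hone, hnhds]) fun x => ?_,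
    hone⟩
  rw [hone, hnhds]
  refine le_antisymm ?_ ?_
  · have := (tendsto_map (f := fun y => y * x)).comp (hconj x)
    simpa [Function.comp_def, Tendsto] using this
  · have := (tendsto_map (f := fun y => x * y)).comp (hconj x⁻¹)
    simpa [Function.comp_def, Tendsto, mul_assoc] using this

/-- A Hausdorff `ω`-balanced paratopological group with countable Hausdorff number is projectively
first countable and Hausdorff. -/
theorem exists_firstCountable_projection {G : Type u} [Group G] [τ : TopologicalSpace G]
    [hτ : ContinuousMul G] [T2Space G] (hb : IsOmegaBalanced G) (hs : hausdorffNumber G ≤ ℵ₀)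
    {U : Set G} (hU : U ∈ 𝓝 (1 : G)) :
    ∃ (Y : Type u) (_ : Group Y) (_ : TopologicalSpace Y) (_ : ParatopologicalGroup Y)
      (h : G →ₜ* Y), T2Space Y ∧ FirstCountableTopology Y ∧ ∃ V ∈ 𝓝 (1 : Y), h ⁻¹' V ⊆ U := by
  have hmul : ∀ U : Set G, U ∈ 𝓝 (1 : G) → ∃ V ∈ 𝓝 (1 : G), ∀ x ∈ V, ∀ y ∈ V, x * y ∈ U := by
    intro U hU
    obtain ⟨V, hV, h1, h⟩ := exists_open_nhds_one_mul_subset hU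
    exact ⟨V, hV.mem_nhds h1, fun x hx y hy => h (mul_mem_mul hx hy)⟩
  choose! M hM hMU using hmul
  choose! 𝒱 h𝒱c h𝒱n h𝒱 using hb
  choose! 𝒲 h𝒲c h𝒲n h𝒲 using fun (U : Set G) (hU : U ∈ 𝓝 (1 : G)) =>
    exists_countable_of_hausdorffNumber_le hs hU
  -- The countable family `γ` generates the neighborhood filter of `1` for a coarser topology: `M V`
  -- gives continuity of multiplication, `𝒱 V` invariance under conjugation, and `𝒲 V` the
  -- separation hypothesis for the Hausdorff quotient.
  obtain ⟨γ, hγc, hUγ, hγn, hγ⟩ := exists_countable_closed_family (p := fun V => V ∈ 𝓝 (1 : G))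
    (fun V => insert (M V) (𝒱 V ∪ 𝒲 V)) (fun V hV => ⟨((h𝒱c V hV).union (h𝒲c V hV)).insert _, by
      rintro W (rfl | hW | hW)
      · exact hM V hV
      · exact h𝒱n V hV W hW
      · exact h𝒲n V hV W hW⟩) hU
  have hgen : ∀ {V}, V ∈ γ → V ∈ generate γ := fun hV => mem_generate_of_mem hV
  have hle : 𝓝 (1 : G) ≤ generate γ := le_generate_iff.2 hγn
  obtain ⟨t, ht, ht1⟩ := exists_topology_of_nhds_one (generate γ) ((pure_le_nhds 1).trans hle)
    (le_generate_iff.2 fun V hV => by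
      have hMV := hgen (hγ V hV (mem_insert _ _))
      refine mem_map.2 (mem_of_superset (prod_mem_prod hMV hMV) ?_)
      rintro ⟨x, y⟩ ⟨hx, hy⟩
      exact hMU V (hγn V hV) x hx y hy)
    (fun x => le_generate_iff.2 fun V hV => by
      obtain ⟨W, hW, hWV⟩ := h𝒱 V (hγn V hV) x
      exact mem_map.2 (mem_of_superset (hgen (hγ V hV (mem_insert_of_mem _ (Or.inl hW))))
        (image_subset_iff.1 hWV)))
  have hcg : (@nhds G t 1).IsCountablyGenerated := by
    rw [ht1]
    exact ⟨⟨γ, hγc, rfl⟩⟩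
  obtain ⟨Y, _, _, _, h, hY2, hY1, hh⟩ := @exists_hausdorff_quotient G _ t ht hcg (by
    intro P hP x hx
    rw [ht1] at hP hx
    have hxγ : γ ⊆ {V | x ∈ V} := fun V hV => h𝒲 V (hγn V hV) (mem_iInter₂.2 fun W hW =>
      hx W (hgen (hγ V hV (mem_insert_of_mem _ (Or.inr hW)))))
    have : pure x ≤ generate γ := le_generate_iff.2 fun V hV => hxγ hV
    exact this hP)
  have hcont : @Continuous G Y τ _ h.toMonoidHom := by
    refine @MonoidHom.continuous_of_tendsto_one G Y _ τ hτ _ _ _ h.toMonoidHom ?_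
    have := @Continuous.tendsto G Y t _ _ h.continuous_toFun 1
    rw [ht1] at this
    have h' : h.toMonoidHom 1 = 1 := map_one _
    rw [← h']
    exact this.mono_left hle
  exact ⟨Y, inferInstance, inferInstance, inferInstance,
    @ContinuousMonoidHom.mk G Y _ _ τ _ h.toMonoidHom hcont, hY2, hY1, hh U (ht1 ▸ hgen hUγ)⟩

/-- A group that admits sufficiently many continuous homomorphisms to first countable Hausdorff
paratopological groups is `ω`-balanced and has countable Hausdorff number. -/
theorem isOmegaBalanced_and_hausdorffNumber_le {K : Type u} [Group K] [TopologicalSpace K]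
    (hK : ∀ U ∈ 𝓝 (1 : K), ∃ (Y : Type u) (_ : Group Y) (_ : TopologicalSpace Y)
      (_ : ParatopologicalGroup Y) (h : K →ₜ* Y), T2Space Y ∧ FirstCountableTopology Y ∧
        ∃ V ∈ 𝓝 (1 : Y), h ⁻¹' V ⊆ U) :
    IsOmegaBalanced K ∧ hausdorffNumber K ≤ ℵ₀ := by
  refine ⟨fun U hU => ?_, hausdorffNumber_le_aleph0 fun U hU => ?_⟩
  all_goals
    obtain ⟨Y, _, _, _, h, _, _, V, hV, hVU⟩ := hK U hU
    obtain ⟨B, hB⟩ := (𝓝 (1 : Y)).exists_antitone_basis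
    have hBn : ∀ n, h ⁻¹' B n ∈ 𝓝 (1 : K) := fun n =>
      (map_continuous h).continuousAt.preimage_mem_nhds (by simpa using hB.mem n)
  -- One countable base of `Y` serves all `x`, since conjugation by `h x` is continuous on `Y`.
  · refine ⟨range fun n => h ⁻¹' B n, countable_range _, forall_mem_range.2 hBn, fun x => ?_⟩
    have hx : (fun y => h x * y * (h x)⁻¹) ⁻¹' V ∈ 𝓝 (1 : Y) :=
      (by fun_prop : Continuous fun y => h x * y * (h x)⁻¹).continuousAt.preimage_mem_nhds
        (by simpa using hV)
    obtain ⟨n, hn⟩ := hB.mem_iff.1 hx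
    refine ⟨_, mem_range_self n, ?_⟩
    rintro _ ⟨v, hv, rfl⟩
    refine hVU ?_
    simpa using hn hv
  · refine ⟨fun n => h ⁻¹' B n, hBn, fun x hx => hVU ?_⟩
    suffices hx1 : h x = 1 by
      rw [mem_preimage, hx1]
      exact mem_of_mem_nhds hV
    by_contra hx1
    obtain ⟨P, Q, hP, hQ, hxP, hQ1, hPQ⟩ := t2_separation hx1
    have hP' : (fun y => h x * y) ⁻¹' P ∈ 𝓝 (1 : Y) :=
      (continuous_const_mul (h x)).continuousAt.preimage_mem_nhds (by simpa using hP.mem_nhds hxP)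
    -- If `x = a * b` with `h a, h b⁻¹ ∈ B n`, then `h a = h x * h b⁻¹` would lie in both `P` and
    -- `Q`.
    obtain ⟨n, hn⟩ := hB.mem_iff.1 (inter_mem hP' (hQ.mem_nhds hQ1))
    obtain ⟨a, ha, b, hb, hab⟩ := mem_iInter.1 hx n
    have hb' : h b⁻¹ ∈ B n := hb
    have hab' : a = x * b⁻¹ := by rw [← show a * b = x from hab]; group
    refine disjoint_left.1 hPQ (hn hb').1 ?_
    have := (hn ha).2
    rwa [hab', map_mul] at this

/-! ### The main result -/

open RaikovCompletion in
theorem t2Space_cCompletion {C : ParaHomClass.{u, v}}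
    (hC : ∀ (X : Type v) (Y : Type u) [Group X] [TopologicalSpace X] [ParatopologicalGroup X]
      [Group Y] [TopologicalSpace Y] [ParatopologicalGroup Y] (h : X →ₜ* Y),
      h ∈ C X Y → IsTopologicalGroup X ∧ IsPseudocompact X)
    {G : Type u} [Group G] [TopologicalSpace G] [ParatopologicalGroup G]
    (hG : IsProjectivelyPsi G) : T2Space (cCompletion C G) := by
  refine ⟨fun x y hxy => ?_⟩
  -- The `T₀` axiom only keeps `x⁻¹ * y` or its inverse out of some closure. That is enough, since
  -- the kernel of the separating homomorphism is symmetric.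
  obtain ⟨U, hU, hxyU⟩ : ∃ U ∈ 𝓝 (1 : G),
      ¬ (((x⁻¹ * y : cCompletion C G) : RaikovCompletion G) ∈ sharpClosure U ∧
        ((x⁻¹ * y : cCompletion C G) : RaikovCompletion G)⁻¹ ∈ sharpClosure U) := by
    by_contra! hcon
    have h1 := eq_one_of_forall_mem (fun U hU => (hcon U hU).1) fun U hU => (hcon U hU).2
    exact hxy (inv_mul_eq_one.1 (Subtype.ext h1))
  obtain ⟨Y, _, _, _, h, hY, hYδ, hhU⟩ := hG U hU
  have hK := cCompletion_le_fiberSubgroup hC h (hYδ 1)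
  have hne : restrictFiber h hK x ≠ restrictFiber h hK y := by
    intro heq
    have h1 : restrictFiber h hK (x⁻¹ * y) ∈ ({1} : Set Y) := by
      rw [mem_singleton_iff, map_mul, map_inv, heq, inv_mul_cancel]
    have h2 : restrictFiber h hK (x⁻¹ * y)⁻¹ ∈ ({1} : Set Y) := by
      rw [map_inv, mem_singleton_iff.1 h1, inv_one, mem_singleton_iff]
    exact hxyU ⟨sharpClosure_mono hhU (mem_sharpClosure_of_restrictFiber_mem h hK h1),
      sharpClosure_mono hhU (mem_sharpClosure_of_restrictFiber_mem h hK h2)⟩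
  exact separated_by_continuous (map_continuous (restrictFiber h hK)) hne

/-- Points of first countable Hausdorff spaces are `G_δ`, so the Hausdorff claim of part 2 reduces
to part 1. -/
theorem IsOmegaBalanced.isProjectivelyPsi {G : Type u} [Group G] [TopologicalSpace G]
    [ContinuousMul G] [T2Space G] (hb : IsOmegaBalanced G) (hs : hausdorffNumber G ≤ ℵ₀) :
    IsProjectivelyPsi G := by
  intro U hU
  obtain ⟨Y, _, _, _, h, _, _, V, hV, hVU⟩ := exists_firstCountable_projection hb hs hU
  refine ⟨Y, inferInstance, inferInstance, inferInstance, h, inferInstance,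
    fun y => IsGδ.singleton y, fun x hx => hVU ?_⟩
  rw [mem_preimage, mem_singleton_iff.1 hx]
  exact mem_of_mem_nhds hV

open RaikovCompletion in
-- Projections of `G` onto first countable Hausdorff groups extend to `𝒞[G]`, and `h⁻¹(V) ⊆ U`
-- persists there with the closure of `U` in place of `U`.
theorem cCompletion_isOmegaBalanced_and_hausdorffNumber_le {C : ParaHomClass.{u, v}}
    (hC : ∀ (X : Type v) (Y : Type u) [Group X] [TopologicalSpace X] [ParatopologicalGroup X]
      [Group Y] [TopologicalSpace Y] [ParatopologicalGroup Y] (h : X →ₜ* Y),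
      h ∈ C X Y → IsTopologicalGroup X ∧ IsPseudocompact X)
    {G : Type u} [Group G] [TopologicalSpace G] [ParatopologicalGroup G]
    [T2Space G] (hb : IsOmegaBalanced G) (hs : hausdorffNumber G ≤ ℵ₀) :
    IsOmegaBalanced (cCompletion C G) ∧ hausdorffNumber (cCompletion C G) ≤ ℵ₀ := by
  refine isOmegaBalanced_and_hausdorffNumber_le fun s hs' => ?_
  rw [nhds_subtype, mem_comap] at hs'
  obtain ⟨T, hT, hTs⟩ := hs'
  obtain ⟨U, hU, hUT⟩ := mem_nhdsOne.1 (nhds_one (G := G) ▸ hT)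
  obtain ⟨Y, _, _, _, h, _, _, V, hV, hVU⟩ := exists_firstCountable_projection hb hs hU
  have hK := cCompletion_le_fiberSubgroup hC h (IsGδ.singleton 1)
  exact ⟨Y, inferInstance, inferInstance, inferInstance, restrictFiber h hK, inferInstance,
    inferInstance, V, hV, fun x hx => hTs (hUT (sharpClosure_mono hVU
      (mem_sharpClosure_of_restrictFiber_mem h hK hx)))⟩

theorem theorem3p3 (C : ParaHomClass.{u, v})
    (hC : ∀ (X : Type v) (Y : Type u) [Group X] [TopologicalSpace X] [ParatopologicalGroup X]
      [Group Y] [TopologicalSpace Y] [ParatopologicalGroup Y] (h : X →ₜ* Y),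
      h ∈ C X Y → IsTopologicalGroup X ∧ IsPseudocompact X)
    (G : Type u) [Group G] [TopologicalSpace G] [ParatopologicalGroup G] :
    (IsProjectivelyPsi G → T2Space (cCompletion C G)) ∧
    (T2Space G → IsOmegaBalanced G → hausdorffNumber G ≤ ℵ₀ →
      IsOmegaBalanced (cCompletion C G) ∧ T2Space (cCompletion C G) ∧
        hausdorffNumber (cCompletion C G) ≤ ℵ₀) := by
  refine ⟨t2Space_cCompletion hC, fun _ hb hs => ?_⟩
  obtain ⟨h1, h2⟩ := cCompletion_isOmegaBalanced_and_hausdorffNumber_le hC hb hs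
  exact ⟨h1, t2Space_cCompletion hC (hb.isProjectivelyPsi hs), h2⟩
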